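/- Let $k$ be a commutative ring (for instance a field or $\mathbb{Z}$), let $K$ be an abstract simplicial complex on the vertex set $[n]=\{1,\dots,n\}$, let $S=k[x_1,\dots,x_n]$, and let $I_K\subseteq S$ be the Stanley–Reisner ideal, generated by the monomials $\prod_{i\in\sigma}x_i$ with $\sigma\subseteq[n]$ not a face of $K$. Let $\mathcal Z_K=\bigcup_{\sigma\in K}\{z\in (D^2)^{n} : z_i\in S^1 \text{ for } i\notin\sigma\}$ (the empty face included) be the moment-angle complex, with the cell structure induced from $D^2=e^0\cup e^1\cup e^2$, where $e^0=\{1\}$, $e^0\cup e^1=S^1$ and $e^2$ is the open disk. Let $C^*_{CW}(\mathcal Z_K;k)$ be its cellular cochain complex, made into a differential graded algebra (DGA) by the cup product dual to the $n$-fold product of the cellular diagonal of $D^2$ that acts on cells by $e^0\mapsto e^0\otimes e^0$ and $e^j\mapsto e^j\otimes e^0+e^0\otimes e^j$ $(j=1,2)$; equivalently $$C^*_{CW}(\mathcal Z_K;k)=\big((S/I_K)\otimes_k\textstyle\bigwedge[u_1,\dots,u_n]\big)/(x_i^2,\,x_iu_i),\qquad du_i=x_i,\ dx_i=0,\ |u_i|=1,\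 |x_i|=2.$$ Let $P=(\cdots\to P_1\to P_0)$ with augmentation $P\to S/I_K$ be a minimal graded free resolution of $S/I_K$ over $S$: each $P_p$ is a graded free $S$-module, the differential $d$ and the augmentation are $S$-linear and preserve the internal degree, $\cdots\to P_1\to P_0\to S/I_K\to 0$ is exact, and $d(P)\subseteq (x_1,\dots,x_n)P$. Suppose that $P$ has a multiplicative structure: an $S$-bilinear product, compatible with the homological and the internal gradings, that makes $P$ an associative unital DGA over $S$ with $ab=(-1)^{pp'}ba$ for $a\in P_p$, $b\in P_{p'}$, and for which the augmentation $P\to S/I_K$ is multiplicative and unital (hence a quasi-isomorphism of DGAs over $S$). Then $C^*_{CW}(\mathcal Z_K;k)$ is formal: it is connected to its cohomology algebra $H^*(C^*_{CW}(\mathcal Z_K;k))$, with zero differential, by a finite sequence of DGA morphisms over $k$, going either way, each of which induces an isomorphism in cohomology. -/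

import Mathlib

universe u

/-! ## Differential graded algebras and formality -/

/-- A differential graded algebra over `k` (cohomological convention): an associative unital
`k`-algebra with a `ℤ`-grading by submodules and a `k`-linear differential of degree `1` that
squares to zero and satisfies the graded Leibniz rule. -/
structure DGA (k : Type u) [CommRing k] : Type (u + 1) where
  carrier : Type u
  [ring : Ring carrier]
  [algebra : Algebra k carrier]
  grade : ℤ → Submodule k carrier
  isInternal : DirectSum.IsInternal grade
  one_mem : (1 : carrier) ∈ grade 0
  mul_mem : ∀ {i j : ℤ} {a b : carrier}, a ∈ grade i → b ∈ grade j → a * b ∈ grade (i + j)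
  d : carrier →ₗ[k] carrier
  d_mem : ∀ {i : ℤ} {a : carrier}, a ∈ grade i → d a ∈ grade (i + 1)
  d_d : ∀ a : carrier, d (d a) = 0
  leibniz : ∀ {i : ℤ} {a : carrier} (b : carrier), a ∈ grade i →
    d (a * b) = d a * b + (i.negOnePow : ℤ) • (a * d b)

namespace DGA

attribute [instance] DGA.ring DGA.algebra

variable {k : Type u} [CommRing k]

/-- A morphism of DGAs: a unital `k`-algebra homomorphism which preserves degrees and commutes
with the differentials. -/
structure Hom (A B : DGA k) where
  toAlgHom : A.carrier →ₐ[k] B.carrier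
  map_grade : ∀ {i : ℤ} {a : A.carrier}, a ∈ A.grade i → toAlgHom a ∈ B.grade i
  map_d : ∀ a : A.carrier, toAlgHom (A.d a) = B.d (toAlgHom a)

section Cohomology

variable (A : DGA k)

theorem grade_induction {p : A.carrier → Prop} (h0 : p 0)
    (hadd : ∀ a b, p a → p b → p (a + b)) (hom : ∀ i, ∀ a ∈ A.grade i, p a) (a : A.carrier) :
    p a := by
  have ha : a ∈ ⨆ i, A.grade i := by
    rw [A.isInternal.submodule_iSup_eq_top]; trivial
  exact Submodule.iSup_induction A.grade (motive := p) ha hom h0 hadd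

theorem d_one : A.d 1 = 0 := by
  have h := A.leibniz (1 : A.carrier) A.one_mem
  simpa using h

theorem d_mul_of_d_eq_zero (a : A.carrier) {b : A.carrier} (hb : A.d b = 0) :
    A.d (a * b) = A.d a * b := by
  induction a using A.grade_induction with
  | h0 => simp
  | hadd x y hx hy => simp [add_mul, hx, hy]
  | hom i x hx => simp [A.leibniz b hx, hb]

/-- The projection of a DGA to its component of degree `i`. -/
noncomputable def proj (i : ℤ) : A.carrier →ₗ[k] A.carrier :=
  letI := A.isInternal.chooseDecomposition
  (A.grade i).subtype ∘ₗ DirectSum.component k ℤ (fun i => A.grade i) i ∘ₗ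
    (DirectSum.decomposeLinearEquiv A.grade).toLinearMap

theorem proj_apply (i : ℤ) (a : A.carrier) : A.proj i a =
    (@DirectSum.decompose _ _ _ _ _ _ _ A.grade A.isInternal.chooseDecomposition a i :
      A.carrier) :=
  rfl

theorem proj_mem (i : ℤ) (a : A.carrier) : A.proj i a ∈ A.grade i := by
  simp [proj]

theorem proj_of_mem {i : ℤ} {a : A.carrier} (ha : a ∈ A.grade i) : A.proj i a = a := by
  let := A.isInternal.chooseDecomposition
  exact DirectSum.decompose_of_mem_same A.grade ha

theorem proj_of_mem_ne {i j : ℤ} {a : A.carrier} (ha : a ∈ A.grade i) (h : i ≠ j) :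
    A.proj j a = 0 := by
  let := A.isInternal.chooseDecomposition
  exact DirectSum.decompose_of_mem_ne A.grade ha h

theorem d_proj (i : ℤ) (a : A.carrier) : A.d (A.proj i a) = A.proj (i + 1) (A.d a) := by
  induction a using A.grade_induction with
  | h0 => simp
  | hadd x y hx hy => simp [hx, hy]
  | hom j x hx =>
    by_cases h : j = i
    · subst h
      rw [A.proj_of_mem hx, A.proj_of_mem (A.d_mem hx)]
    · rw [A.proj_of_mem_ne hx h, A.proj_of_mem_ne (A.d_mem hx) (by omega), map_zero]

theorem mem_span_proj (a : A.carrier) (N : AddSubgroup A.carrier)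
    (h : ∀ i, A.proj i a ∈ N) : a ∈ N := by
  classical
  let := A.isInternal.chooseDecomposition
  rw [← DirectSum.sum_support_decompose A.grade a]
  exact sum_mem fun i _ => h i

theorem exists_d_eq_mul_d {a : A.carrier} (ha : A.d a = 0) (b : A.carrier) :
    ∃ c, A.d c = a * A.d b := by
  have key : ∀ i, ∃ c, A.d c = A.proj i a * A.d b := fun i => by
    refine ⟨(i.negOnePow : ℤ) • (A.proj i a * b), ?_⟩
    rw [map_zsmul, A.leibniz b (A.proj_mem i a), A.d_proj, ha, map_zero, zero_mul, zero_add,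
      smul_smul, ← Units.val_mul, ← Int.negOnePow_add, Int.negOnePow_even _ ⟨i, rfl⟩]
    simp
  let N : AddSubgroup A.carrier :=
    (LinearMap.range A.d).toAddSubgroup.comap (AddMonoidHom.mulRight (A.d b))
  exact A.mem_span_proj a N key

/-- The cocycles of a DGA. -/
def cocycles : Subalgebra k A.carrier where
  carrier := {a | A.d a = 0}
  mul_mem' {a b} (ha : A.d a = 0) (hb : A.d b = 0) := by
    change A.d (a * b) = 0
    rw [A.d_mul_of_d_eq_zero a hb, ha, zero_mul]
  add_mem' {a b} (ha : A.d a = 0) (hb : A.d b = 0) := by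
    change A.d (a + b) = 0
    rw [map_add, ha, hb, add_zero]
  algebraMap_mem' r := by
    change A.d (algebraMap k A.carrier r) = 0
    rw [Algebra.algebraMap_eq_smul_one, map_smul, A.d_one, smul_zero]

/-- The coboundaries of a DGA, as an ideal of the algebra of cocycles. -/
def coboundaries : Ideal A.cocycles where
  carrier := {z | ∃ a, A.d a = z}
  add_mem' := by
    rintro x y ⟨a, ha⟩ ⟨b, hb⟩
    exact ⟨a + b, by simp [ha, hb]⟩
  zero_mem' := ⟨0, by simp⟩
  smul_mem' := by
    rintro z w ⟨b, hb⟩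
    obtain ⟨c, hc⟩ := A.exists_d_eq_mul_d z.2 b
    exact ⟨c, by rw [hc, hb]; rfl⟩

instance : A.coboundaries.IsTwoSided where
  mul_mem_of_left := by
    rintro z w ⟨b, hb⟩
    exact ⟨b * w, by rw [A.d_mul_of_d_eq_zero b w.2, hb]; rfl⟩

/-- The cohomology algebra of a DGA: cocycles modulo coboundaries. -/
abbrev Cohomology : Type u := A.cocycles ⧸ A.coboundaries

/-- The classes of the cocycles of degree `i`. -/
def cohomologyGrade (i : ℤ) : Submodule k A.Cohomology :=
  ((A.grade i).comap A.cocycles.val.toLinearMap).map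
    (Ideal.Quotient.mkₐ k A.coboundaries).toLinearMap

theorem mem_cohomologyGrade {i : ℤ} {x : A.Cohomology} :
    x ∈ A.cohomologyGrade i ↔
      ∃ z : A.cocycles, (z : A.carrier) ∈ A.grade i ∧ Ideal.Quotient.mk A.coboundaries z = x :=
  Iff.rfl

theorem cohomologyGrade_isInternal : DirectSum.IsInternal A.cohomologyGrade := by
  refine DirectSum.isInternal_submodule_of_iSupIndep_of_iSup_eq_top ?_ ?_
  · rw [iSupIndep_def]
    intro i
    rw [Submodule.disjoint_def]
    intro x hx hx'
    obtain ⟨w, hw, rfl⟩ := A.mem_cohomologyGrade.1 hx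
    have key : ∃ z : A.cocycles, A.proj i z = 0 ∧
        Ideal.Quotient.mk A.coboundaries z = Ideal.Quotient.mk A.coboundaries w := by
      rw [iSup_subtype'] at hx'
      refine Submodule.iSup_induction _
        (motive := fun x => ∃ z : A.cocycles, A.proj i z = 0 ∧
          Ideal.Quotient.mk A.coboundaries z = x) hx' ?_ ⟨0, by simp⟩ ?_
      · rintro ⟨j, hj⟩ x hx
        obtain ⟨z, hz, rfl⟩ := A.mem_cohomologyGrade.1 hx
        exact ⟨z, A.proj_of_mem_ne hz hj, rfl⟩
      · rintro _ _ ⟨z, hz, rfl⟩ ⟨z', hz', rfl⟩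
        exact ⟨z + z', by simp [hz, hz'], by simp⟩
    obtain ⟨z, hz, hzw⟩ := key
    obtain ⟨a, ha⟩ := Ideal.Quotient.eq.1 hzw.symm
    refine Ideal.Quotient.eq_zero_iff_mem.2 ⟨A.proj (i - 1) a, ?_⟩
    rw [A.d_proj, ha, sub_add_cancel]
    simp [hz, A.proj_of_mem hw]
  · refine eq_top_iff.2 fun x _ => ?_
    obtain ⟨z, rfl⟩ := Ideal.Quotient.mk_surjective x
    have hz : ∀ i, A.proj i z ∈ A.cocycles := fun i => by
      change A.d _ = 0
      rw [A.d_proj, show A.d z = 0 from z.2, map_zero]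
    let N : AddSubgroup A.carrier :=
      ((⨆ i, A.cohomologyGrade i).toAddSubgroup.comap
        (Ideal.Quotient.mk A.coboundaries).toAddMonoidHom).map
          (A.cocycles.val : A.cocycles →+ A.carrier)
    have hN : (z : A.carrier) ∈ N := A.mem_span_proj z N fun i =>
      ⟨⟨A.proj i z, hz i⟩, Submodule.mem_iSup_of_mem i ⟨_, A.proj_mem i z, rfl⟩, rfl⟩
    obtain ⟨w, hw, hwz⟩ := hN
    have : w = z := Subtype.ext hwz
    exact this ▸ hw

/-- The cohomology algebra of a DGA, regarded as a DGA with zero differential. -/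
def cohomology : DGA k where
  carrier := A.Cohomology
  grade := A.cohomologyGrade
  isInternal := A.cohomologyGrade_isInternal
  one_mem := ⟨1, A.one_mem, rfl⟩
  mul_mem := by
    rintro i j _ _ ⟨z, hz, rfl⟩ ⟨w, hw, rfl⟩
    exact ⟨z * w, A.mul_mem hz hw, rfl⟩
  d := 0
  d_mem _ := zero_mem _
  d_d _ := rfl
  leibniz _ _ := by simp

end Cohomology

section QuasiIsomorphism

variable {A B : DGA k}

/-- The restriction of a morphism of DGAs to cocycles. -/
def Hom.cocyclesMap (f : Hom A B) : A.cocycles →ₐ[k] B.cocycles :=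
  (f.toAlgHom.comp A.cocycles.val).codRestrict B.cocycles fun z => by
    change B.d (f.toAlgHom z) = 0
    rw [← f.map_d, show A.d z = 0 from z.2, map_zero]

/-- The homomorphism induced in cohomology by a morphism of DGAs. -/
def Hom.cohomologyMap (f : Hom A B) : A.Cohomology →ₐ[k] B.Cohomology :=
  Ideal.Quotient.liftₐ A.coboundaries
    ((Ideal.Quotient.mkₐ k B.coboundaries).comp f.cocyclesMap) (by
      rintro z ⟨a, ha⟩
      refine Ideal.Quotient.eq_zero_iff_mem.2 ⟨f.toAlgHom a, ?_⟩
      rw [← f.map_d, ha]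
      rfl)

/-- A quasi-isomorphism: a morphism of DGAs inducing an isomorphism in cohomology. -/
def Hom.IsQuasiIso (f : Hom A B) : Prop :=
  Function.Bijective f.cohomologyMap

end QuasiIsomorphism

/-- Two DGAs are connected by a quasi-isomorphism from the first to the second. -/
def QuasiIsoTo (A B : DGA k) : Prop :=
  ∃ f : Hom A B, f.IsQuasiIso

/-- A DGA is formal if it is connected to its cohomology algebra, with zero differential,
by a finite sequence of quasi-isomorphisms of DGAs going either way. -/
def IsFormal (A : DGA k) : Prop :=
  Relation.EqvGen QuasiIsoTo A A.cohomology

end DGA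

/-! ## The moment-angle complex and its cells -/

/-- The polyhedral product: the union over the faces `σ` of `K` (including the
empty one) of the sets of points of `D ^ n` whose coordinates outside `σ` lie in `A`. -/
def polyhedralProduct {n : ℕ} {X : Type*} (K : AbstractSimplicialComplex (Fin n))
    (D A : Set X) : Set (Fin n → X) :=
  {z | (∀ i, z i ∈ D) ∧ ∃ σ : Finset (Fin n), (σ = ∅ ∨ σ ∈ K) ∧ ∀ i, i ∉ σ → z i ∈ A}

/-- The moment-angle complex of `K`, inside the `n`-fold product of the unit disk. -/
def momentAngleComplex {n : ℕ} (K : AbstractSimplicialComplex (Fin n)) : Set (Fin n → ℂ) :=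
  polyhedralProduct K (Metric.closedBall (0 : ℂ) 1) (Metric.sphere (0 : ℂ) 1)

/-- The open cells of the unit disk, one in each dimension `0`, `1`, `2`: the point `1`,
the rest of the unit circle, and the open disk. -/
def diskCell : Fin 3 → Set ℂ
  | 0 => {1}
  | 1 => Metric.sphere (0 : ℂ) 1 \ {1}
  | 2 => Metric.ball (0 : ℂ) 1

/-- The open cells of the moment-angle complex: the products of open cells of the disk that are
contained in it. A cell is recorded by the dimensions of its factors. -/
@[ext]
structure MomentAngleCell {n : ℕ} (K : AbstractSimplicialComplex (Fin n)) : Type where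
  factor : Fin n → Fin 3
  subset : Set.univ.pi (fun i => diskCell (factor i)) ⊆ momentAngleComplex K

namespace MomentAngleCell

variable {n : ℕ} {K : AbstractSimplicialComplex (Fin n)}

theorem pi_subset_iff (c : Fin n → Fin 3) :
    Set.univ.pi (fun i => diskCell (c i)) ⊆ momentAngleComplex K ↔
      (Finset.univ.filter fun i => c i = 2) = ∅ ∨ (Finset.univ.filter fun i => c i = 2) ∈ K := by
  constructor
  · intro h
    let pt : Fin 3 → ℂ := ![1, -1, 0]
    have hpt : ∀ a, pt a ∈ diskCell a := by
      intro a
      fin_cases a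
      · simp [pt, diskCell]
      · simp only [pt, diskCell]
        refine ⟨by simp, ?_⟩
        norm_num
      · simp [pt, diskCell]
    obtain ⟨-, σ, hσ, hz⟩ := h (show (fun i => pt (c i)) ∈ _ from fun i _ => hpt (c i))
    have hsub : (Finset.univ.filter fun i => c i = 2) ⊆ σ := by
      intro i hi
      by_contra hiσ
      have : pt (c i) ∈ Metric.sphere (0 : ℂ) 1 := hz i hiσ
      rw [(Finset.mem_filter.1 hi).2] at this
      simp [pt] at this
    rcases hσ with rfl | hσ
    · exact Or.inl (Finset.subset_empty.1 hsub)
    · rcases Finset.eq_empty_or_nonempty (Finset.univ.filter fun i => c i = 2) with h | h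
      · exact Or.inl h
      · exact Or.inr ((K.isRelLowerSet_faces hσ).2 hsub h)
  · intro h z hz
    refine ⟨fun i => ?_, _, h, fun i hi => ?_⟩
    · have : z i ∈ diskCell (c i) := hz i trivial
      generalize c i = a at this
      fin_cases a
      · have h1 : z i = 1 := this
        simp [h1]
      · exact Metric.sphere_subset_closedBall this.1
      · exact Metric.ball_subset_closedBall this
    · have h1 : z i ∈ diskCell (c i) := hz i trivial
      have h2 : c i ≠ 2 := by simpa using hi
      generalize c i = a at h1 h2
      fin_cases a
      · have h1 : z i = 1 := h1
        simp [h1]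
      · exact h1.1
      · exact absurd rfl h2

theorem of_imp (c : MomentAngleCell K) (c' : Fin n → Fin 3) (h : ∀ i, c' i = 2 → c.factor i = 2) :
    Set.univ.pi (fun i => diskCell (c' i)) ⊆ momentAngleComplex K := by
  rw [pi_subset_iff]
  have hsub : (Finset.univ.filter fun i => c' i = 2) ⊆ Finset.univ.filter fun i => c.factor i = 2 :=
    fun i hi => by simpa using h i (by simpa using hi)
  rcases Finset.eq_empty_or_nonempty (Finset.univ.filter fun i => c' i = 2) with h' | h'
  · exact Or.inl h'
  · rcases (pi_subset_iff c.factor).1 c.subset with hc | hc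
    · exact Or.inl (Finset.subset_empty.1 (hc ▸ hsub))
    · exact Or.inr ((K.isRelLowerSet_faces hc).2 hsub h')

/-- The dimension of a cell. -/
def dim (c : MomentAngleCell K) : ℕ := ∑ i, (c.factor i : ℕ)

/-- The coordinates in which a cell has positive dimension. -/
def support (c : MomentAngleCell K) : Finset (Fin n) := Finset.univ.filter fun i => c.factor i ≠ 0

/-- The cell obtained by replacing the factors outside `s` by the `0`-cell. -/
def restrict (c : MomentAngleCell K) (s : Finset (Fin n)) : MomentAngleCell K :=
  ⟨fun i => if i ∈ s then c.factor i else 0, c.of_imp _ fun i h => by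
    split_ifs at h
    · exact h
    · simp at h⟩

/-- The cell obtained by replacing the `i`-th factor by the `1`-cell if it is the `2`-cell
(whose boundary is the `1`-cell). -/
def face (c : MomentAngleCell K) (i : Fin n) : MomentAngleCell K :=
  ⟨fun j => if j = i ∧ c.factor j = 2 then 1 else c.factor j, c.of_imp _ fun j h => by
    split_ifs at h
    · simp at h
    · exact h⟩

/-- The number of `1`-dimensional factors in front of the `i`-th factor, which has the parity
of the dimension of the product of the factors in front of the `i`-th. -/
def onesBefore (c : MomentAngleCell K) (i : Fin n) : ℕ :=
  (Finset.univ.filter fun j => j < i ∧ c.factor j = 1).card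

/-- The number of transpositions of `1`-dimensional factors in the reordering of `c` as
`c.restrict s` followed by `c.restrict sᶜ`. -/
def inversions (c : MomentAngleCell K) (s : Finset (Fin n)) : ℕ :=
  (Finset.univ.filter fun p : Fin n × Fin n =>
    p.2 < p.1 ∧ p.1 ∈ s ∧ p.2 ∉ s ∧ c.factor p.1 = 1 ∧ c.factor p.2 = 1).card

theorem ext_factor {c c' : MomentAngleCell K} (h : ∀ i, c.factor i = c'.factor i) : c = c' :=
  MomentAngleCell.ext (funext h)

theorem restrict_apply (c : MomentAngleCell K) (s : Finset (Fin n)) (i : Fin n) :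
    (c.restrict s).factor i = if i ∈ s then c.factor i else 0 := rfl

theorem face_apply (c : MomentAngleCell K) (i j : Fin n) :
    (c.face i).factor j = if j = i ∧ c.factor j = 2 then 1 else c.factor j := rfl

theorem mem_support {c : MomentAngleCell K} {i : Fin n} : i ∈ c.support ↔ c.factor i ≠ 0 := by
  simp [support]

theorem restrict_restrict (c : MomentAngleCell K) (s t : Finset (Fin n)) :
    (c.restrict s).restrict t = c.restrict (s ∩ t) := by
  refine ext_factor fun i => ?_
  simp only [restrict_apply, Finset.mem_inter]
  split_ifs <;> simp_all

theorem restrict_congr (c : MomentAngleCell K) {s t : Finset (Fin n)}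
    (h : c.support ∩ s = c.support ∩ t) : c.restrict s = c.restrict t := by
  refine ext_factor fun i => ?_
  have := Finset.ext_iff.1 h i
  simp only [Finset.mem_inter, mem_support] at this
  simp only [restrict_apply]
  split_ifs <;> grind [Finset.mem_compl]

theorem support_restrict (c : MomentAngleCell K) (s : Finset (Fin n)) :
    (c.restrict s).support = c.support ∩ s := by
  ext i
  simp only [mem_support, restrict_apply, Finset.mem_inter]
  split_ifs <;> simp_all

theorem support_face (c : MomentAngleCell K) (i : Fin n) : (c.face i).support = c.support := by
  ext j
  simp only [mem_support, face_apply]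
  by_cases h : j = i ∧ c.factor j = 2
  · rw [if_pos h, h.2]; decide
  · rw [if_neg h]

theorem restrict_support (c : MomentAngleCell K) : c.restrict c.support = c := by
  refine ext_factor fun i => ?_
  simp only [restrict_apply, mem_support]
  split_ifs <;> simp_all

theorem support_eq_empty_iff {c : MomentAngleCell K} : c.support = ∅ ↔ ∀ i, c.factor i = 0 := by
  simp [support, Finset.filter_eq_empty_iff]

theorem dim_restrict_add (c : MomentAngleCell K) (s : Finset (Fin n)) :
    (c.restrict s).dim + (c.restrict sᶜ).dim = c.dim := by
  simp only [dim, ← Finset.sum_add_distrib, restrict_apply, Finset.mem_compl]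
  refine Finset.sum_congr rfl fun i _ => ?_
  split_ifs <;> simp_all

theorem dim_face (c : MomentAngleCell K) (i : Fin n) (h : c.factor i = 2) :
    (c.face i).dim + 1 = c.dim := by
  simp only [dim]
  rw [← Finset.add_sum_erase _ _ (Finset.mem_univ i),
    ← Finset.add_sum_erase _ _ (Finset.mem_univ i)]
  have : ∑ x ∈ Finset.univ.erase i, (((c.face i).factor x : Fin 3) : ℕ) =
      ∑ x ∈ Finset.univ.erase i, ((c.factor x : Fin 3) : ℕ) :=
    Finset.sum_congr rfl fun j hj => by
      rw [face_apply, if_neg fun h => (Finset.mem_erase.1 hj).1 h.1]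
  rw [this, face_apply, if_pos ⟨rfl, h⟩, h]
  simp only [Fin.val_one, Fin.val_two]
  omega

theorem dim_eq_zero_of_support {c : MomentAngleCell K} (h : c.support = ∅) : c.dim = 0 := by
  simp [dim, support_eq_empty_iff.1 h]

theorem inversions_assoc (c : MomentAngleCell K) {s t : Finset (Fin n)} (h : t ⊆ s) :
    c.inversions s + (c.restrict s).inversions t =
      c.inversions t + (c.restrict tᶜ).inversions (s \ t) := by
  simp only [inversions, Finset.card_filter, ← Finset.sum_add_distrib]
  refine Finset.sum_congr rfl fun p _ => ?_
  have h1 := @h p.1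
  have h2 := @h p.2
  simp only [restrict_apply, Finset.mem_sdiff, Finset.mem_compl]
  by_cases a1 : p.1 ∈ s <;> by_cases a2 : p.2 ∈ s <;> by_cases b1 : p.1 ∈ t <;>
    by_cases b2 : p.2 ∈ t <;> simp_all

theorem onesBefore_face (c : MomentAngleCell K) (i j : Fin n) (hi : c.factor i = 2) :
    (c.face i).onesBefore j = c.onesBefore j + if i < j then 1 else 0 := by
  have : (if i < j then 1 else 0) = ∑ l : Fin n, if l = i ∧ i < j then 1 else 0 := by
    simp [ite_and]
  rw [this]
  simp only [onesBefore, Finset.card_filter, ← Finset.sum_add_distrib]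
  simp only [face_apply]
  refine Finset.sum_congr rfl fun l _ => ?_
  by_cases h : l = i
  · subst h; simp [hi]
  · simp [h]

theorem onesBefore_split (c : MomentAngleCell K) (s : Finset (Fin n)) (i : Fin n) :
    c.onesBefore i = (c.restrict s).onesBefore i + (c.restrict sᶜ).onesBefore i := by
  simp only [onesBefore, Finset.card_filter, ← Finset.sum_add_distrib]
  simp only [restrict_apply, Finset.mem_compl]
  refine Finset.sum_congr rfl fun l _ => ?_
  by_cases h : l ∈ s <;> simp [h]

theorem inversions_face_of_mem (c : MomentAngleCell K) {s : Finset (Fin n)} {i : Fin n}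
    (hi : c.factor i = 2) (his : i ∈ s) :
    (c.face i).inversions s = c.inversions s + (c.restrict sᶜ).onesBefore i := by
  simp only [inversions, onesBefore, Finset.card_filter, Fintype.sum_prod_type]
  simp only [face_apply, restrict_apply, Finset.mem_compl]
  have : (∑ l : Fin n, if l < i ∧ (if l ∉ s then c.factor l else 0) = 1 then 1 else 0) =
      ∑ m : Fin n, ∑ l : Fin n,
        if m = i ∧ l < i ∧ (if l ∉ s then c.factor l else 0) = 1 then 1 else 0 := by
    rw [Finset.sum_comm]
    simp only [ite_and, Finset.sum_ite_eq', Finset.mem_univ, if_true]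
  rw [this]
  simp only [← Finset.sum_add_distrib]
  refine Finset.sum_congr rfl fun m _ => Finset.sum_congr rfl fun l _ => ?_
  by_cases h : m = i
  · subst h
    by_cases hl : l ∈ s
    · simp [hl]
    · have : l ≠ m := fun h => hl (h ▸ his)
      simp [hl, his, hi, this]
  · by_cases hl : l ∈ s
    · simp [h, hl]
    · have : l ≠ i := fun h => hl (h ▸ his)
      simp [hl, h, this]

theorem inversions_face_of_notMem (c : MomentAngleCell K) {s : Finset (Fin n)} {i : Fin n}
    (hi : c.factor i = 2) (his : i ∉ s) :
    (c.face i).inversions s + (c.restrict s).onesBefore i =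
      c.inversions s + (Finset.univ.filter fun j => (c.restrict s).factor j = 1).card := by
  simp only [inversions, onesBefore, Finset.card_filter, Fintype.sum_prod_type_right]
  simp only [face_apply, restrict_apply]
  have e1 : (∑ l : Fin n, if l < i ∧ (if l ∈ s then c.factor l else 0) = 1 then 1 else 0) =
      ∑ m : Fin n, ∑ l : Fin n,
        if m = i ∧ l < i ∧ (if l ∈ s then c.factor l else 0) = 1 then 1 else 0 := by
    rw [Finset.sum_comm]
    simp only [ite_and, Finset.sum_ite_eq', Finset.mem_univ, if_true]
  have e2 : (∑ l : Fin n, if (if l ∈ s then c.factor l else 0) = 1 then 1 else 0) =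
      ∑ m : Fin n, ∑ l : Fin n,
        if m = i ∧ (if l ∈ s then c.factor l else 0) = 1 then 1 else 0 := by
    rw [Finset.sum_comm]
    simp only [ite_and, Finset.sum_ite_eq', Finset.mem_univ, if_true]
  refine (congrArg₂ (· + ·) rfl e1).trans (Eq.trans ?_ (congrArg₂ (· + ·) rfl e2).symm)
  simp only [← Finset.sum_add_distrib]
  refine Finset.sum_congr rfl fun m _ => Finset.sum_congr rfl fun l _ => ?_
  by_cases h : m = i
  · subst h
    by_cases hl : l ∈ s
    · have hlm : l ≠ m := fun h => his (h ▸ hl)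
      rcases lt_or_gt_of_ne hlm with hlt | hlt
      · simp [hl, his, hi, hlm, hlt, hlt.not_gt]
      · simp [hl, his, hi, hlm, hlt, hlt.not_gt]
    · simp [hl]
  · by_cases hl : l ∈ s
    · have : l ≠ i := fun h => his (h ▸ hl)
      simp [hl, h, this]
    · simp [h, hl]

theorem dim_parity (c : MomentAngleCell K) :
    ∃ m, c.dim = (Finset.univ.filter fun j => c.factor j = 1).card + 2 * m := by
  refine ⟨∑ i, if c.factor i = 2 then 1 else 0, ?_⟩
  simp only [dim, Finset.card_filter, Finset.mul_sum, ← Finset.sum_add_distrib]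
  refine Finset.sum_congr rfl fun i _ => ?_
  generalize c.factor i = a
  fin_cases a <;> simp

theorem face_restrict_of_mem (c : MomentAngleCell K) {s : Finset (Fin n)} {i : Fin n}
    (his : i ∈ s) : (c.face i).restrict s = (c.restrict s).face i := by
  refine ext_factor fun j => ?_
  simp only [restrict_apply, face_apply]
  split_ifs <;> simp_all

theorem face_restrict_of_notMem (c : MomentAngleCell K) {s : Finset (Fin n)} {i : Fin n}
    (his : i ∉ s) : (c.face i).restrict s = c.restrict s := by
  refine ext_factor fun j => ?_
  simp only [restrict_apply, face_apply]
  split_ifs <;> simp_all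

theorem face_face (c : MomentAngleCell K) (i j : Fin n) :
    (c.face i).face j = (c.face j).face i := by
  refine ext_factor fun l => ?_
  simp only [face_apply]
  split_ifs <;> simp_all

end MomentAngleCell

/-! ## The cellular cochain algebra -/

/-- Cellular cochains of the moment-angle complex with coefficients in `k`: functions on the
(finite) set of cells. -/
structure CellularCochain {n : ℕ} (k : Type u) (K : AbstractSimplicialComplex (Fin n)) :
    Type u where
  toFun : MomentAngleCell K → k

namespace CellularCochain

variable {n : ℕ} {k : Type u} {K : AbstractSimplicialComplex (Fin n)}

instance : CoeFun (CellularCochain k K) (fun _ => MomentAngleCell K → k) := ⟨toFun⟩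

@[ext]
theorem ext_apply {f g : CellularCochain k K} (h : ∀ c, f c = g c) : f = g := by
  cases f
  cases g
  congr
  exact funext h

/-- Cochains are functions on the cells. -/
def equivFun (k : Type u) (K : AbstractSimplicialComplex (Fin n)) :
    CellularCochain k K ≃ (MomentAngleCell K → k) :=
  ⟨toFun, mk, fun _ => rfl, fun _ => rfl⟩

variable [CommRing k]

instance : AddCommGroup (CellularCochain k K) := (equivFun k K).addCommGroup

instance : Module k (CellularCochain k K) := (equivFun k K).module k

@[simp] theorem zero_apply (c : MomentAngleCell K) : (0 : CellularCochain k K) c = 0 := rfl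

@[simp] theorem add_apply (f g : CellularCochain k K) (c : MomentAngleCell K) :
    (f + g) c = f c + g c := rfl

@[simp] theorem smul_apply (r : k) (f : CellularCochain k K) (c : MomentAngleCell K) :
    (r • f) c = r * f c := rfl

/-- The coboundary, dual to the cellular boundary of a product of cells of the disk: the
boundary of the `2`-cell is the `1`-cell, the boundaries of the `0`-cell and of the `1`-cell vanish,
and the `i`-th factor contributes with the sign given by the dimension of the factors in
front of it. -/
def d : CellularCochain k K →ₗ[k] CellularCochain k K where
  toFun f := ⟨fun c => ∑ i with c.factor i = 2, (-1) ^ c.onesBefore i * f (c.face i)⟩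
  map_add' f g := by
    ext c
    simp [mul_add, Finset.sum_add_distrib]
  map_smul' r f := by
    ext c
    simp [Finset.mul_sum, mul_left_comm]

/-- Evaluation of cochains at a cell. -/
def evalHom (c : MomentAngleCell K) : CellularCochain k K →+ k where
  toFun f := f c
  map_zero' := rfl
  map_add' _ _ := rfl

theorem d_apply (f : CellularCochain k K) (c : MomentAngleCell K) :
    d f c = ∑ i with c.factor i = 2, (-1) ^ c.onesBefore i * f (c.face i) := rfl

/-- The unit: the cochain with value `1` on the `0`-cell. -/
instance : One (CellularCochain k K) :=
  ⟨⟨fun c => if c.support = ∅ then 1 else 0⟩⟩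

/-- The cup product, dual to the cellular diagonal. The diagonal approximation of the disk acts
on cells by `e⁰ ↦ e⁰ × e⁰` and `eⁱ ↦ eⁱ × e⁰ + e⁰ × eⁱ` for `i = 1, 2`, and its `n`-fold product acts
on a product cell `c` by distributing the factors of positive dimension among the two sides in
all possible ways, with the sign of the reordering. -/
instance : Mul (CellularCochain k K) :=
  ⟨fun f g => ⟨fun c => ∑ s ∈ c.support.powerset,
    (-1) ^ c.inversions s * (f (c.restrict s) * g (c.restrict sᶜ))⟩⟩

theorem one_apply (c : MomentAngleCell K) :
    (1 : CellularCochain k K) c = if c.support = ∅ then 1 else 0 := rfl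

theorem mul_apply (f g : CellularCochain k K) (c : MomentAngleCell K) :
    (f * g) c = ∑ s ∈ c.support.powerset,
      (-1) ^ c.inversions s * (f (c.restrict s) * g (c.restrict sᶜ)) := rfl

protected theorem mul_one (f : CellularCochain k K) : f * 1 = f := by
  ext c
  rw [mul_apply, Finset.sum_eq_single c.support]
  · have h : c.inversions c.support = 0 := by
      rw [MomentAngleCell.inversions, Finset.card_eq_zero, Finset.filter_eq_empty_iff]
      rintro p - ⟨-, -, h, -, h'⟩
      exact h (MomentAngleCell.mem_support.2 (by simp [h']))
    rw [h, c.restrict_support, one_apply, c.support_restrict]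
    simp
  · intro s hs hne
    rw [one_apply, c.support_restrict, if_neg]
    · simp
    · intro h
      refine hne (Finset.Subset.antisymm (Finset.mem_powerset.1 hs) fun i hi => ?_)
      by_contra his
      have : i ∈ c.support ∩ sᶜ := by simp [hi, his]
      simp [h] at this
  · simp

protected theorem one_mul (f : CellularCochain k K) : 1 * f = f := by
  ext c
  rw [mul_apply, Finset.sum_eq_single ∅]
  · have h : c.restrict (∅ᶜ) = c := by
      conv_rhs => rw [← c.restrict_support]
      exact c.restrict_congr (by simp)
    rw [h, one_apply, c.support_restrict]
    simp [MomentAngleCell.inversions]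
  · intro s hs hne
    rw [one_apply, c.support_restrict, Finset.inter_eq_right.2 (Finset.mem_powerset.1 hs),
      if_neg hne]
    simp
  · simp

protected theorem mul_assoc (f g h : CellularCochain k K) : f * g * h = f * (g * h) := by
  ext c
  simp only [mul_apply, Finset.mul_sum, Finset.sum_mul]
  rw [Finset.sum_sigma', Finset.sum_sigma']
  refine Finset.sum_nbij' (fun x => ⟨x.2, x.1 \ x.2⟩) (fun x => ⟨x.1 ∪ x.2, x.1⟩) ?_ ?_ ?_ ?_ ?_
  · rintro ⟨s, t⟩ hx
    simp only [Finset.mem_sigma, Finset.mem_powerset, c.support_restrict] at hx ⊢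
    grind [Finset.mem_compl]
  · rintro ⟨s, t⟩ hx
    simp only [Finset.mem_sigma, Finset.mem_powerset, c.support_restrict] at hx ⊢
    grind [Finset.mem_compl]
  · rintro ⟨s, t⟩ hx
    simp only [Finset.mem_sigma, Finset.mem_powerset, c.support_restrict] at hx ⊢
    have : t ⊆ s := by grind [Finset.mem_compl]
    simp [Finset.union_sdiff_of_subset this]
  · rintro ⟨s, t⟩ hx
    simp only [Finset.mem_sigma, Finset.mem_powerset, c.support_restrict] at hx ⊢
    have : Disjoint s t := by
      rw [Finset.disjoint_left]
      grind [Finset.mem_compl]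
    simp [Finset.union_sdiff_cancel_left this]
  · rintro ⟨s, t⟩ hx
    simp only [Finset.mem_sigma, Finset.mem_powerset, c.support_restrict] at hx ⊢
    have hts : t ⊆ s := by grind [Finset.mem_compl]
    have e := congrArg (fun m => (-1 : k) ^ m) (c.inversions_assoc hts)
    simp only [pow_add] at e
    simp only [c.restrict_restrict]
    have e1 : s ∩ t = t := by grind [Finset.mem_compl]
    have e2 : s ∩ tᶜ = s \ t := by grind [Finset.mem_compl]
    have e3 : tᶜ ∩ (s \ t) = s \ t := by grind [Finset.mem_compl]
    have e4 : tᶜ ∩ (s \ t)ᶜ = sᶜ := by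
      ext i
      have := @hts i
      simp only [Finset.mem_inter, Finset.mem_compl, Finset.mem_sdiff]
      tauto
    rw [e1, e2, e3, e4]
    linear_combination
      (f (c.restrict t) * g (c.restrict (s \ t)) * h (c.restrict sᶜ)) * e

instance : Ring (CellularCochain k K) :=
  { (inferInstance : AddCommGroup (CellularCochain k K)) with
    mul := (· * ·)
    one := 1
    mul_assoc := CellularCochain.mul_assoc
    one_mul := CellularCochain.one_mul
    mul_one := CellularCochain.mul_one
    zero_mul := fun f => by ext c; simp [mul_apply]
    mul_zero := fun f => by ext c; simp [mul_apply]
    left_distrib := fun f g h => by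
      ext c; simp [mul_apply, mul_add, Finset.sum_add_distrib]
    right_distrib := fun f g h => by
      ext c; simp [mul_apply, mul_add, add_mul, Finset.sum_add_distrib] }

instance : Algebra k (CellularCochain k K) :=
  Algebra.ofModule
    (fun r f g => by
      ext c
      simp only [mul_apply, smul_apply, Finset.mul_sum]
      exact Finset.sum_congr rfl fun s _ => by ring)
    (fun r f g => by
      ext c
      simp only [mul_apply, smul_apply, Finset.mul_sum]
      exact Finset.sum_congr rfl fun s _ => by ring)

/-- The cochains of degree `i`: those supported on the cells of dimension `i`. -/
def grade (k : Type u) [CommRing k] (K : AbstractSimplicialComplex (Fin n)) (i : ℤ) :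
    Submodule k (CellularCochain k K) where
  carrier := {f | ∀ c, f c ≠ 0 → (c.dim : ℤ) = i}
  add_mem' {f g} hf hg c h := by
    by_cases h0 : f c = 0
    · exact hg c fun h1 => h (by simp [h0, h1])
    · exact hf c h0
  zero_mem' c h := (h rfl).elim
  smul_mem' r f hf c h := hf c fun h0 => h (by simp [h0])

theorem mem_grade {i : ℤ} {f : CellularCochain k K} :
    f ∈ grade k K i ↔ ∀ c, f c ≠ 0 → (c.dim : ℤ) = i := Iff.rfl

theorem grade_isInternal : DirectSum.IsInternal (grade k K) := by
  refine DirectSum.isInternal_submodule_of_iSupIndep_of_iSup_eq_top ?_ ?_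
  · rw [iSupIndep_def]
    intro i
    rw [Submodule.disjoint_def]
    intro f hf hf'
    have hle : ⨆ j, ⨆ (_ : j ≠ i), grade k K j ≤
        { carrier := {f : CellularCochain k K | ∀ c, (c.dim : ℤ) = i → f c = 0}
          add_mem' := fun {f g} hf hg c h => by simp [hf c h, hg c h]
          zero_mem' := fun c _ => rfl
          smul_mem' := fun r f hf c h => by simp [hf c h] } :=
      iSup₂_le fun j hj f hf c h => by
        by_contra h0
        exact hj ((hf c h0).symm.trans h)
    ext c
    by_contra h0
    exact h0 (hle hf' c (hf c h0))
  · refine eq_top_iff.2 fun f _ => ?_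
    have hf : f = ∑ m ∈ Finset.range (2 * n + 1),
        (⟨fun c => if c.dim = m then f c else 0⟩ : CellularCochain k K) := by
      ext c
      have hc : c.dim < 2 * n + 1 := by
        have : c.dim ≤ ∑ _i : Fin n, 2 := Finset.sum_le_sum fun i _ => by omega
        simp at this
        omega
      have : (∑ m ∈ Finset.range (2 * n + 1),
          (⟨fun c => if c.dim = m then f c else 0⟩ : CellularCochain k K)) c =
          ∑ m ∈ Finset.range (2 * n + 1), if c.dim = m then f c else 0 :=
        map_sum (evalHom c) _ _
      rw [this, Finset.sum_ite_eq, if_pos (Finset.mem_range.2 hc)]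
    rw [hf]
    refine sum_mem fun m _ => Submodule.mem_iSup_of_mem (m : ℤ) fun c h => ?_
    by_contra h'
    exact h (if_neg fun h => h' (by rw [h]))

theorem one_mem_grade : (1 : CellularCochain k K) ∈ grade k K 0 := by
  intro c h
  rw [one_apply] at h
  rw [MomentAngleCell.dim_eq_zero_of_support]
  · rfl
  · by_contra h'
    exact h (if_neg h')

theorem mul_mem_grade {i j : ℤ} {f g : CellularCochain k K} (hf : f ∈ grade k K i)
    (hg : g ∈ grade k K j) : f * g ∈ grade k K (i + j) := by
  intro c h
  rw [mul_apply] at h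
  obtain ⟨s, -, hs⟩ := Finset.exists_ne_zero_of_sum_ne_zero h
  have h1 := hf (c.restrict s) fun h => hs (by simp [h])
  have h2 := hg (c.restrict sᶜ) fun h => hs (by simp [h])
  rw [← h1, ← h2, ← c.dim_restrict_add s]
  push_cast
  rfl

theorem d_mem_grade {i : ℤ} {f : CellularCochain k K} (hf : f ∈ grade k K i) :
    d f ∈ grade k K (i + 1) := by
  intro c h
  rw [d_apply] at h
  obtain ⟨s, hs, h⟩ := Finset.exists_ne_zero_of_sum_ne_zero h
  have h1 := hf (c.face s) fun h' => h (by simp [h'])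
  have := c.dim_face s (Finset.mem_filter.1 hs).2
  omega

theorem d_d (f : CellularCochain k K) : d (d f) = 0 := by
  ext c
  simp only [d_apply, Finset.mul_sum, zero_apply]
  rw [Finset.sum_sigma']
  have hmem : ∀ x : (_ : Fin n) × Fin n,
      x ∈ (Finset.univ.filter fun i => c.factor i = 2).sigma
        (fun i => Finset.univ.filter fun j => (c.face i).factor j = 2) ↔
      x.1 ≠ x.2 ∧ c.factor x.1 = 2 ∧ c.factor x.2 = 2 := by
    rintro ⟨i, j⟩
    simp only [Finset.mem_sigma, Finset.mem_filter, Finset.mem_univ, true_and]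
    rw [MomentAngleCell.face_apply]
    by_cases h : j = i
    · subst h
      by_cases h' : c.factor j = 2 <;> simp [h']
    · simp [h, Ne.symm h]
  refine Finset.sum_involution (fun x _ => ⟨x.2, x.1⟩) ?_ ?_ ?_ ?_
  · rintro ⟨i, j⟩ hx
    obtain ⟨hij, hi, hj⟩ := (hmem _).1 hx
    simp only at hij hi hj ⊢
    rw [c.onesBefore_face i j hi, c.onesBefore_face j i hj, c.face_face j i]
    rcases lt_or_gt_of_ne hij with h | h
    · rw [if_pos h, if_neg h.not_gt]
      ring
    · rw [if_pos h, if_neg h.not_gt]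
      ring
  · rintro ⟨i, j⟩ hx - heq
    obtain ⟨hij, -, -⟩ := (hmem _).1 hx
    simp only [Sigma.mk.injEq] at heq
    exact hij heq.1.symm
  · rintro ⟨i, j⟩ hx
    rw [hmem] at hx ⊢
    exact ⟨hx.1.symm, hx.2.2, hx.2.1⟩
  · rintro ⟨i, j⟩ hx
    rfl

theorem d_leibniz {i : ℤ} {f : CellularCochain k K} (g : CellularCochain k K)
    (hf : f ∈ grade k K i) : d (f * g) = d f * g + (i.negOnePow : ℤ) • (f * d g) := by
  have hz : ∀ (z : ℤ) (x : CellularCochain k K) (c : MomentAngleCell K),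
      (z • x) c = z * x c := fun z x c => by
    change z • (x c) = _
    simp
  ext c
  simp only [d_apply, mul_apply, add_apply, hz, Finset.mul_sum, Finset.sum_mul, c.support_face]
  rw [Finset.sum_comm, ← Finset.sum_add_distrib]
  refine Finset.sum_congr rfl fun s _ => ?_
  have e1 : (Finset.univ.filter fun i => (c.restrict s).factor i = 2) =
      (Finset.univ.filter fun i => c.factor i = 2).filter (· ∈ s) := by
    ext i
    simp only [Finset.mem_filter, Finset.mem_univ, true_and]
    rw [MomentAngleCell.restrict_apply]
    split_ifs with h <;> simp [h]
  have e2 : (Finset.univ.filter fun i => (c.restrict sᶜ).factor i = 2) =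
      (Finset.univ.filter fun i => c.factor i = 2).filter (· ∉ s) := by
    ext i
    simp only [Finset.mem_filter, Finset.mem_univ, true_and]
    rw [MomentAngleCell.restrict_apply]
    split_ifs with h
    · simp [Finset.mem_compl.1 h]
    · simp [not_not.1 (fun h' => h (Finset.mem_compl.2 h'))]
  rw [e1, e2, ← Finset.sum_filter_add_sum_filter_not _ (· ∈ s)]
  congr 1
  · refine Finset.sum_congr rfl fun j hj => ?_
    obtain ⟨hj, hjs⟩ := Finset.mem_filter.1 hj
    have hj := (Finset.mem_filter.1 hj).2
    rw [c.face_restrict_of_mem hjs, c.face_restrict_of_notMem (by simpa using hjs),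
      c.inversions_face_of_mem hj hjs, c.onesBefore_split s j]
    have h1 : ((-1 : k) ^ (c.restrict sᶜ).onesBefore j) ^ 2 = 1 := by
      rw [← pow_mul, mul_comm, pow_mul]; simp
    simp only [pow_add]
    linear_combination ((-1) ^ (c.restrict s).onesBefore j * (-1) ^ c.inversions s *
      (f ((c.restrict s).face j) * g (c.restrict sᶜ))) * h1
  · refine Finset.sum_congr rfl fun j hj => ?_
    obtain ⟨hj, hjs⟩ := Finset.mem_filter.1 hj
    have hj := (Finset.mem_filter.1 hj).2
    rw [c.face_restrict_of_notMem hjs, c.face_restrict_of_mem (by simpa using hjs)]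
    by_cases h0 : f (c.restrict s) = 0
    · simp [h0]
    · have hdim := hf _ h0
      obtain ⟨m, hm⟩ := (c.restrict s).dim_parity
      have hsign : (((i.negOnePow : ℤˣ) : ℤ) : k) =
          (-1) ^ (Finset.univ.filter fun j => (c.restrict s).factor j = 1).card := by
        rw [← hdim, hm, Int.negOnePow_def, zpow_natCast, pow_add, pow_mul]
        push_cast
        norm_num
      have hinv := congrArg (fun m => (-1 : k) ^ m) (c.inversions_face_of_notMem hj hjs)
      simp only [pow_add] at hinv
      rw [hsign, c.onesBefore_split s j]
      simp only [pow_add]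
      linear_combination ((-1) ^ (c.restrict sᶜ).onesBefore j *
        (f (c.restrict s) * g ((c.restrict sᶜ).face j))) * hinv

end CellularCochain

/-- The cellular cochain algebra of the moment-angle complex of `K` with coefficients in `k`. -/
noncomputable def cellularCochainAlgebra {n : ℕ} (k : Type u) [CommRing k]
    (K : AbstractSimplicialComplex (Fin n)) : DGA k where
  carrier := CellularCochain k K
  grade := CellularCochain.grade k K
  isInternal := CellularCochain.grade_isInternal
  one_mem := CellularCochain.one_mem_grade
  mul_mem := CellularCochain.mul_mem_grade
  d := CellularCochain.d
  d_mem := CellularCochain.d_mem_grade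
  d_d := CellularCochain.d_d
  leibniz := CellularCochain.d_leibniz

/-! ## Minimal free resolutions of Stanley-Reisner rings -/

/-- The Stanley-Reisner ideal of `K`: it is generated by the square-free monomials of the
non-faces of `K`. -/
noncomputable def stanleyReisnerIdeal {n : ℕ} (k : Type u) [CommRing k]
    (K : AbstractSimplicialComplex (Fin n)) : Ideal (MvPolynomial (Fin n) k) :=
  Ideal.span {f | ∃ σ : Finset (Fin n), σ.Nonempty ∧ σ ∉ K ∧ f = ∏ i ∈ σ, MvPolynomial.X i}

/-- A minimal graded free resolution `⋯ → P₁ → P₀ → S/I → 0` of the Stanley-Reisner ring `S/I` over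
the polynomial ring `S`, where the variables of `S` have internal degree `1`. The carrier is the
direct sum of all the `Pₚ`, and `piece p q` is the component of `Pₚ` of internal degree `q`. -/
structure MinimalFreeResolution {n : ℕ} (k : Type u) [CommRing k]
    (K : AbstractSimplicialComplex (Fin n)) : Type (u + 1) where
  carrier : Type u
  [addCommGroup : AddCommGroup carrier]
  [module : Module (MvPolynomial (Fin n) k) carrier]
  piece : ℕ → ℤ → AddSubgroup carrier
  isInternal : DirectSum.IsInternal fun pq : ℕ × ℤ => piece pq.1 pq.2
  smul_mem : ∀ {p : ℕ} {q m : ℤ} {f : MvPolynomial (Fin n) k} {x : carrier},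
    f.IsWeightedHomogeneous (fun _ => (1 : ℤ)) m → x ∈ piece p q → f • x ∈ piece p (m + q)
  /-- Each `Pₚ` is a graded free module: there is a basis of homogeneous elements. -/
  free : ∃ (ι : Type u) (b : Module.Basis ι (MvPolynomial (Fin n) k) carrier),
    ∀ i, ∃ p q, b i ∈ piece p q
  /-- The differential, of homological degree `-1` and internal degree `0`. -/
  d : carrier →ₗ[MvPolynomial (Fin n) k] carrier
  d_mem : ∀ {p : ℕ} {q : ℤ} {x : carrier}, x ∈ piece (p + 1) q → d x ∈ piece p q
  d_zero : ∀ {q : ℤ} {x : carrier}, x ∈ piece 0 q → d x = 0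
  d_d : ∀ x : carrier, d (d x) = 0
  /-- The augmentation `P₀ → S/I`, extended by zero to the other `Pₚ`. -/
  ε : carrier →ₗ[MvPolynomial (Fin n) k] MvPolynomial (Fin n) k ⧸ stanleyReisnerIdeal k K
  ε_piece : ∀ {q : ℤ} {x : carrier}, x ∈ piece 0 q →
    ∃ f : MvPolynomial (Fin n) k, f.IsWeightedHomogeneous (fun _ => (1 : ℤ)) q ∧
      ε x = Ideal.Quotient.mk (stanleyReisnerIdeal k K) f
  ε_pos : ∀ {p : ℕ} {q : ℤ} {x : carrier}, x ∈ piece (p + 1) q → ε x = 0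
  ε_d : ∀ x : carrier, ε (d x) = 0
  ε_surjective : Function.Surjective ε
  exact : ∀ x : carrier, d x = 0 → ε x = 0 → ∃ y, d y = x
  /-- Minimality: the entries of the matrices of the differential have positive degree. -/
  minimal : ∀ x : carrier, d x ∈
    Ideal.span (Set.range (MvPolynomial.X : Fin n → MvPolynomial (Fin n) k)) •
      (⊤ : Submodule (MvPolynomial (Fin n) k) carrier)

namespace MinimalFreeResolution

attribute [instance] MinimalFreeResolution.addCommGroup MinimalFreeResolution.module

/-- A multiplicative structure on a minimal free resolution `P` of `S/I`: an `S`-bilinear product,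
compatible with the gradings, making `P` a graded-commutative (associative, unital) DGA over `S`
for which the augmentation `P → S/I` is a morphism of DGAs. -/
structure MultiplicativeStructure {n : ℕ} {k : Type u} [CommRing k]
    {K : AbstractSimplicialComplex (Fin n)} (P : MinimalFreeResolution k K) : Type u where
  mul : P.carrier →ₗ[MvPolynomial (Fin n) k] P.carrier →ₗ[MvPolynomial (Fin n) k] P.carrier
  one : P.carrier
  one_mem : one ∈ P.piece 0 0
  mul_mem : ∀ {p p' : ℕ} {q q' : ℤ} {x y : P.carrier},
    x ∈ P.piece p q → y ∈ P.piece p' q' → mul x y ∈ P.piece (p + p') (q + q')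
  one_mul : ∀ x, mul one x = x
  mul_one : ∀ x, mul x one = x
  mul_assoc : ∀ x y z, mul (mul x y) z = mul x (mul y z)
  mul_comm : ∀ {p p' : ℕ} {q q' : ℤ} {x y : P.carrier},
    x ∈ P.piece p q → y ∈ P.piece p' q' → mul x y = (-1 : ℤ) ^ (p * p') • mul y x
  leibniz : ∀ {p : ℕ} {q : ℤ} {x : P.carrier} (y : P.carrier), x ∈ P.piece p q →
    P.d (mul x y) = mul (P.d x) y + (-1 : ℤ) ^ p • mul x (P.d y)
  ε_one : P.ε one = 1
  ε_mul : ∀ x y, P.ε (mul x y) = P.ε x * P.ε y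

end MinimalFreeResolution

/-!
Let `S = k[x₁, …, xₙ]`, with variables of degree `2`, let `R = S / I_K`, and let `P` be the
resolution with its multiplication. For a DGA `E` over `S` let `E⟨u⟩` be the Koszul algebra
obtained by adjoining variables `u_i` of degree `1` with `d u_i = x_i`. The cellular cochain algebra
is linked to an algebra with zero differential by quasi-isomorphisms

`C ← R⟨u⟩ ← P⟨u⟩ → P / (x₁, …, xₙ) P`.

The differential of the last algebra vanishes because `P` is minimal
(`MinimalFreeResolution.MultiplicativeStructure.truncatedKoszul_d_eq_zero`), and a DGA that is
connected to one with zero differential is formal (`DGA.isFormal_of_eqvGen`).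

All algebras `E⟨u⟩` are built by adjoining one variable at a time, so that an element is a pair
`a + b u` and no signs of shuffles occur. The middle arrow comes from the augmentation
`P → R`, since adjoining a variable preserves quasi-isomorphisms
(`ParamDGA.Hom.isQuasiIso_adjoin`).

The outer arrows are two cases of one statement. The ideal of `E⟨u⟩` generated by `x ^ (e + 1)` and
`x ^ e * u` is acyclic if `x ^ (e + 1) * a = 0` implies `x ^ e * a = 0`
(`ParamDGA.isQuasiIso_truncateMk`). For `e = 0` the quotient is `E / x`; for `e = 1` its relations
are those of the cellular cochains of the disk. In order to treat the variables in turn, the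
condition has to survive in the quotients by the preceding variables. This is achieved by an
additive map `D` with `D (x ^ (e + 1) * a) = x ^ e * a` that commutes with the other variables
(`ParamDGA.IsDivisible`), because such a map descends to these quotients. On the free
`S`-module `P` it is the coefficientwise division by a variable, and on `R` it divides the monomials
that are divisible by `x ^ 2` by `x` and kills the others; this respects `I_K`, as it does not
change the supports of monomials.

Finally the quotient of `R⟨u⟩` for `e = 1` is the cellular cochain algebra
(`ParamDGA.bijective_of_isTruncated`): it is spanned by ordered products with one factor `1`, `u_i`
or `x_i` for each `i`, those in which the indices of the `x_i` form a non-face vanish, and the others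
map to the basis of cochains dual to the cells.
-/


/-! ### Differential graded algebras: sign involution, quotients, quasi-isomorphisms -/

namespace DGA

variable {k : Type u} [CommRing k]

/-- A family of submodules is an internal grading as soon as it comes with additive maps that
behave like the projections to its members, and spans. -/
theorem isInternal_of_projections {M : Type*} [AddCommGroup M] [Module k M]
    {G : ℤ → Submodule k M} (π : ℤ → M →+ M) (hself : ∀ i, ∀ a ∈ G i, π i a = a)
    (hne : ∀ i j, i ≠ j → ∀ a ∈ G i, π j a = 0) (hspan : ∀ a, a ∈ ⨆ i, G i) :
    DirectSum.IsInternal G := by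
  refine DirectSum.isInternal_submodule_of_iSupIndep_of_iSup_eq_top ?_
    (eq_top_iff.2 fun a _ => hspan a)
  rw [iSupIndep_def]
  intro i
  rw [Submodule.disjoint_def]
  intro a ha ha'
  rw [← hself i a ha]
  rw [iSup_subtype'] at ha'
  exact Submodule.iSup_induction _ (motive := fun a => π i a = 0) ha'
    (fun j a ha => hne j i j.2 a ha) (map_zero _) fun a b ha hb => by rw [map_add, ha, hb, add_zero]

section SignInvolution

variable (A : DGA k)

/-- The sign involution of a DGA, which multiplies the elements of degree `i` by `(-1) ^ i`. -/
noncomputable def sgn : A.carrier →ₗ[k] A.carrier :=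
  letI := A.isInternal.chooseDecomposition
  DirectSum.toModule k ℤ A.carrier (fun i => (i.negOnePow : ℤ) • (A.grade i).subtype) ∘ₗ
    (DirectSum.decomposeLinearEquiv A.grade).toLinearMap

variable {A}

theorem sgn_of_mem {i : ℤ} {a : A.carrier} (ha : a ∈ A.grade i) :
    A.sgn a = (i.negOnePow : ℤ) • a := by
  let := A.isInternal.chooseDecomposition
  simp only [sgn, LinearMap.comp_apply, LinearEquiv.coe_coe,
    DirectSum.decomposeLinearEquiv_apply]
  rw [DirectSum.decompose_of_mem A.grade ha]
  exact DirectSum.toModule_lof k i _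

theorem sgn_of_mem_even {i : ℤ} (hi : Even i) {a : A.carrier} (ha : a ∈ A.grade i) :
    A.sgn a = a := by
  simp [sgn_of_mem ha, Int.negOnePow_even i hi]

theorem sgn_of_mem_odd {i : ℤ} (hi : Odd i) {a : A.carrier} (ha : a ∈ A.grade i) :
    A.sgn a = -a := by
  simp [sgn_of_mem ha, Int.negOnePow_odd i hi]

theorem even_or_odd_induction {p : A.carrier → Prop} (h0 : p 0)
    (hadd : ∀ a b, p a → p b → p (a + b)) (heven : ∀ i, Even i → ∀ a ∈ A.grade i, p a)
    (hodd : ∀ i, Odd i → ∀ a ∈ A.grade i, p a) (a : A.carrier) : p a :=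
  A.grade_induction h0 hadd (fun i a ha => (Int.even_or_odd i).elim
    (fun h => heven i h a ha) fun h => hodd i h a ha) a

@[simp]
theorem sgn_sgn (a : A.carrier) : A.sgn (A.sgn a) = a := by
  induction a using even_or_odd_induction with
  | h0 => simp
  | hadd a b ha hb => simp [ha, hb]
  | heven i hi a ha => simp [sgn_of_mem_even hi ha]
  | hodd i hi a ha => simp [sgn_of_mem_odd hi ha]

@[simp]
theorem sgn_one : A.sgn 1 = 1 := sgn_of_mem_even Even.zero A.one_mem

@[simp]
theorem sgn_mul (a b : A.carrier) : A.sgn (a * b) = A.sgn a * A.sgn b := by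
  induction a using A.grade_induction with
  | h0 => simp
  | hadd a b ha hb => simp [add_mul, ha, hb]
  | hom i a ha =>
    induction b using A.grade_induction with
    | h0 => simp
    | hadd a b ha hb => simp [mul_add, ha, hb]
    | hom j b hb =>
      rw [sgn_of_mem (A.mul_mem ha hb), sgn_of_mem ha, sgn_of_mem hb, Int.negOnePow_add,
        smul_mul_smul_comm, Units.val_mul]

theorem sgn_mem {i : ℤ} {a : A.carrier} (ha : a ∈ A.grade i) : A.sgn a ∈ A.grade i := by
  rw [sgn_of_mem ha]
  exact zsmul_mem ha _

theorem d_sgn (a : A.carrier) : A.d (A.sgn a) = -A.sgn (A.d a) := by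
  induction a using even_or_odd_induction with
  | h0 => simp
  | hadd a b ha hb => simp [ha, hb, add_comm]
  | heven i hi a ha => simp [sgn_of_mem_even hi ha, sgn_of_mem_odd hi.add_one (A.d_mem ha)]
  | hodd i hi a ha => simp [sgn_of_mem_odd hi ha, sgn_of_mem_even hi.add_one (A.d_mem ha)]

/-- The graded Leibniz rule, without reference to degrees. -/
theorem d_mul (a b : A.carrier) : A.d (a * b) = A.d a * b + A.sgn a * A.d b := by
  induction a using A.grade_induction with
  | h0 => simp
  | hadd x y hx hy => simp only [add_mul, map_add, hx, hy]; abel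
  | hom i a ha => rw [A.leibniz b ha, sgn_of_mem ha, smul_mul_assoc]

theorem proj_mul_of_mem {i : ℤ} {a : A.carrier} (ha : a ∈ A.grade i) (j : ℤ) (b : A.carrier) :
    A.proj j (a * b) = a * A.proj (j - i) b := by
  induction b using A.grade_induction with
  | h0 => simp
  | hadd x y hx hy => simp [mul_add, hx, hy]
  | hom l b hb =>
    by_cases h : l = j - i
    · rw [← h, A.proj_of_mem hb, A.proj_of_mem]
      have : j = i + l := by omega
      exact this ▸ A.mul_mem ha hb
    · rw [A.proj_of_mem_ne hb h, A.proj_of_mem_ne (A.mul_mem ha hb) (by omega), mul_zero]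

end SignInvolution

section Homs

variable {A B C : DGA k}

theorem Hom.map_sgn (f : Hom A B) (a : A.carrier) :
    f.toAlgHom (A.sgn a) = B.sgn (f.toAlgHom a) := by
  induction a using A.grade_induction with
  | h0 => simp
  | hadd a b ha hb => simp [ha, hb]
  | hom i a ha => rw [sgn_of_mem ha, sgn_of_mem (f.map_grade ha), map_zsmul]

variable (A) in
/-- The identity morphism of a DGA. -/
def Hom.id : Hom A A where
  toAlgHom := AlgHom.id k A.carrier
  map_grade h := h
  map_d _ := rfl

/-- The composition of morphisms of DGAs. -/
def Hom.comp (g : Hom B C) (f : Hom A B) : Hom A C where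
  toAlgHom := g.toAlgHom.comp f.toAlgHom
  map_grade h := g.map_grade (f.map_grade h)
  map_d a := by simp [f.map_d, g.map_d]

/-- A quasi-isomorphism in terms of elements: a cocycle is a coboundary if its image is, and every
cocycle of the target is the image of a cocycle up to a coboundary. -/
theorem Hom.isQuasiIso_iff (f : Hom A B) : f.IsQuasiIso ↔
    (∀ z, A.d z = 0 → ∀ b, B.d b = f.toAlgHom z → ∃ a, A.d a = z) ∧
    ∀ w, B.d w = 0 → ∃ z, A.d z = 0 ∧ ∃ b, B.d b = f.toAlgHom z - w := by
  have hmap (z : A.cocycles) : f.cohomologyMap (Ideal.Quotient.mk _ z) =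
      Ideal.Quotient.mk _ (f.cocyclesMap z) := rfl
  refine and_congr ?_ ?_
  · rw [injective_iff_map_eq_zero]
    refine ⟨fun h z hz b hb => ?_, fun h x hx => ?_⟩
    · exact Ideal.Quotient.eq_zero_iff_mem.1 (h (Ideal.Quotient.mk _ ⟨z, hz⟩)
        (by rw [hmap]; exact Ideal.Quotient.eq_zero_iff_mem.2 ⟨b, hb⟩))
    · obtain ⟨z, rfl⟩ := Ideal.Quotient.mk_surjective x
      rw [hmap] at hx
      obtain ⟨b, hb⟩ := Ideal.Quotient.eq_zero_iff_mem.1 hx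
      exact Ideal.Quotient.eq_zero_iff_mem.2 (h z z.2 b hb)
  · refine ⟨fun h w hw => ?_, fun h y => ?_⟩
    · obtain ⟨x, hx⟩ := h (Ideal.Quotient.mk _ ⟨w, hw⟩)
      obtain ⟨z, rfl⟩ := Ideal.Quotient.mk_surjective x
      rw [hmap] at hx
      exact ⟨z, z.2, Ideal.Quotient.eq.1 hx⟩
    · obtain ⟨w, rfl⟩ := Ideal.Quotient.mk_surjective y
      obtain ⟨z, hz, b, hb⟩ := h w w.2
      exact ⟨Ideal.Quotient.mk _ ⟨z, hz⟩, by rw [hmap]; exact Ideal.Quotient.eq.2 ⟨b, hb⟩⟩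

theorem Hom.IsQuasiIso.comp {g : Hom B C} {f : Hom A B} (hg : g.IsQuasiIso)
    (hf : f.IsQuasiIso) : (g.comp f).IsQuasiIso := by
  have : (g.comp f).cohomologyMap = g.cohomologyMap.comp f.cohomologyMap := by
    refine AlgHom.ext fun x => ?_
    obtain ⟨z, rfl⟩ := Ideal.Quotient.mk_surjective x
    rfl
  rw [Hom.IsQuasiIso, this, AlgHom.coe_comp]
  exact Function.Bijective.comp hg hf

theorem Hom.isQuasiIso_id : (Hom.id A).IsQuasiIso :=
  (Hom.isQuasiIso_iff _).2 ⟨fun _ _ b hb => ⟨b, hb⟩, fun w hw => ⟨w, hw, 0, by simp [Hom.id]⟩⟩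

theorem Hom.isQuasiIso_of_bijective (f : Hom A B) (hf : Function.Bijective f.toAlgHom) :
    f.IsQuasiIso := by
  refine f.isQuasiIso_iff.2 ⟨fun z hz b hb => ?_, fun w hw => ?_⟩
  · obtain ⟨a, rfl⟩ := hf.2 b
    exact ⟨a, hf.1 (by rw [f.map_d, hb])⟩
  · obtain ⟨z, rfl⟩ := hf.2 w
    exact ⟨z, hf.1 (by rw [f.map_d, hw, map_zero]), 0, by simp⟩

/-- A surjective morphism of DGAs with acyclic kernel is a quasi-isomorphism. -/
theorem Hom.isQuasiIso_of_surjective (f : Hom A B) (hf : Function.Surjective f.toAlgHom)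
    (hker : ∀ z, f.toAlgHom z = 0 → A.d z = 0 → ∃ y, f.toAlgHom y = 0 ∧ A.d y = z) :
    f.IsQuasiIso := by
  refine f.isQuasiIso_iff.2 ⟨fun z hz b hb => ?_, fun w hw => ?_⟩
  · obtain ⟨a, rfl⟩ := hf b
    obtain ⟨y, -, hy⟩ := hker (z - A.d a) (by rw [map_sub, f.map_d, hb, sub_self])
      (by rw [map_sub, hz, A.d_d, sub_self])
    exact ⟨y + a, by rw [map_add, hy, sub_add_cancel]⟩
  · obtain ⟨a, rfl⟩ := hf w
    obtain ⟨y, hy0, hy⟩ := hker (A.d a) (by rw [f.map_d, hw]) (A.d_d a)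
    exact ⟨a - y, by rw [map_sub, hy, sub_self], 0, by simp [hy0]⟩

end Homs

section Formality

variable {A B : DGA k}

/-- The morphism of cohomology DGAs induced by a morphism of DGAs. -/
def Hom.cohomologyHom (f : Hom A B) : Hom A.cohomology B.cohomology where
  toAlgHom := f.cohomologyMap
  map_grade := by
    rintro i _ ⟨z, hz, rfl⟩
    exact ⟨f.cocyclesMap z, f.map_grade hz, rfl⟩
  map_d _ := map_zero _

theorem QuasiIsoTo.cohomology (h : QuasiIsoTo A B) : QuasiIsoTo A.cohomology B.cohomology := by
  obtain ⟨f, hf⟩ := h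
  exact ⟨f.cohomologyHom, f.cohomologyHom.isQuasiIso_of_bijective hf⟩

/-- A DGA with zero differential is its own cohomology. -/
theorem quasiIsoTo_cohomology_of_d_eq_zero (hA : ∀ a, A.d a = 0) :
    QuasiIsoTo A A.cohomology := by
  let f : Hom A A.cohomology :=
    { toAlgHom := (Ideal.Quotient.mkₐ k A.coboundaries).comp
        ((AlgHom.id k A.carrier).codRestrict A.cocycles hA)
      map_grade := fun {i a} ha => ⟨⟨a, hA a⟩, ha, rfl⟩
      map_d := fun a => (congrArg _ (hA a)).trans (map_zero _) }
  refine ⟨f, f.isQuasiIso_of_bijective ⟨(injective_iff_map_eq_zero _).2 fun a ha => ?_,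
    fun x => ?_⟩⟩
  · obtain ⟨b, hb⟩ := Ideal.Quotient.eq_zero_iff_mem.1 ha
    exact hb.symm.trans (hA b)
  · obtain ⟨z, rfl⟩ := Ideal.Quotient.mk_surjective x
    exact ⟨z, rfl⟩

/-- A DGA connected by quasi-isomorphisms to one with zero differential is formal. -/
theorem isFormal_of_eqvGen (h : Relation.EqvGen QuasiIsoTo A B) (hB : ∀ b, B.d b = 0) :
    A.IsFormal := by
  have hcoh : Relation.EqvGen QuasiIsoTo A.cohomology B.cohomology := by
    clear hB
    induction h with
    | rel A B h => exact .rel _ _ h.cohomology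
    | refl A => exact .refl _
    | symm A B _ ih => exact .symm _ _ ih
    | trans A B C _ _ ih ih' => exact .trans _ _ _ ih ih'
  exact .trans _ _ _ h (.trans _ _ _ (.rel _ _ (quasiIsoTo_cohomology_of_d_eq_zero hB))
    (.symm _ _ hcoh))

end Formality

section Quotient

variable (A : DGA k) (J : Ideal A.carrier) [J.IsTwoSided]

/-- The quotient of a DGA by a homogeneous two-sided ideal that is stable under the
differential. -/
def quotient (hd : ∀ a ∈ J, A.d a ∈ J) (hproj : ∀ i, ∀ a ∈ J, A.proj i a ∈ J) : DGA k where
  carrier := A.carrier ⧸ J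
  grade i := (A.grade i).map (Ideal.Quotient.mkₐ k J).toLinearMap
  isInternal := by
    refine isInternal_of_projections (fun i => QuotientAddGroup.map J.toAddSubgroup
      J.toAddSubgroup (A.proj i).toAddMonoidHom (hproj i)) ?_ ?_ fun x => ?_
    · rintro i _ ⟨a, ha, rfl⟩
      exact congrArg (Ideal.Quotient.mk J) (A.proj_of_mem ha)
    · rintro i j h _ ⟨a, ha, rfl⟩
      exact (congrArg (Ideal.Quotient.mk J) (A.proj_of_mem_ne ha h)).trans (map_zero _)
    · obtain ⟨a, rfl⟩ := Ideal.Quotient.mk_surjective x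
      induction a using A.grade_induction with
      | h0 => rw [map_zero]; exact zero_mem _
      | hadd a b ha hb => rw [map_add]; exact add_mem ha hb
      | hom i a ha => exact Submodule.mem_iSup_of_mem i ⟨a, ha, rfl⟩
  one_mem := ⟨1, A.one_mem, rfl⟩
  mul_mem := by
    rintro i j _ _ ⟨a, ha, rfl⟩ ⟨b, hb, rfl⟩
    exact ⟨a * b, A.mul_mem ha hb, rfl⟩
  d :=
    { QuotientAddGroup.map J.toAddSubgroup J.toAddSubgroup A.d.toAddMonoidHom hd with
      map_smul' := fun r x => by
        obtain ⟨a, rfl⟩ := Ideal.Quotient.mk_surjective x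
        exact congrArg (Ideal.Quotient.mk J) (A.d.map_smul r a) }
  d_mem := by
    rintro i _ ⟨a, ha, rfl⟩
    exact ⟨A.d a, A.d_mem ha, rfl⟩
  d_d x := by
    obtain ⟨a, rfl⟩ := Ideal.Quotient.mk_surjective x
    exact congrArg (Ideal.Quotient.mk J) (A.d_d a)
  leibniz := by
    rintro i _ y ⟨a, ha, rfl⟩
    obtain ⟨b, rfl⟩ := Ideal.Quotient.mk_surjective y
    exact congrArg (Ideal.Quotient.mk J) (A.leibniz b ha)

variable (hd : ∀ a ∈ J, A.d a ∈ J) (hproj : ∀ i, ∀ a ∈ J, A.proj i a ∈ J)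

/-- The projection to a quotient DGA. -/
def quotientMk : Hom A (A.quotient J hd hproj) where
  toAlgHom := Ideal.Quotient.mkₐ k J
  map_grade ha := ⟨_, ha, rfl⟩
  map_d _ := rfl

theorem quotientMk_surjective :
    Function.Surjective (A.quotientMk J hd hproj).toAlgHom :=
  Ideal.Quotient.mk_surjective

theorem quotientMk_eq_zero {a : A.carrier} :
    (A.quotientMk J hd hproj).toAlgHom a = 0 ↔ a ∈ J :=
  Ideal.Quotient.eq_zero_iff_mem

/-- A morphism of DGAs that kills an ideal factors through the quotient. -/
def quotientLift {B : DGA k} (f : Hom A B) (hf : ∀ a ∈ J, f.toAlgHom a = 0) :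
    Hom (A.quotient J hd hproj) B where
  toAlgHom := Ideal.Quotient.liftₐ J f.toAlgHom hf
  map_grade := by
    rintro i _ ⟨a, ha, rfl⟩
    exact f.map_grade ha
  map_d x := by
    obtain ⟨a, rfl⟩ := Ideal.Quotient.mk_surjective x
    exact f.map_d a

/-- The additive map of a quotient DGA induced by an additive map that preserves the ideal. -/
def quotientMap (D : A.carrier →+ A.carrier) (hD : ∀ a ∈ J, D a ∈ J) :
    (A.quotient J hd hproj).carrier →+ (A.quotient J hd hproj).carrier :=
  QuotientAddGroup.map J.toAddSubgroup J.toAddSubgroup D hD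

end Quotient

end DGA

/-! ### Adjoining a variable that kills a central cocycle -/

/-- A DGA over `k` with central cocycles `x 0, …, x (n - 1)` of degree `2`; in other words, a DGA
over the polynomial ring `k[x₁, …, xₙ]` whose variables have degree `2`. -/
structure ParamDGA (k : Type u) [CommRing k] (n : ℕ) extends DGA k where
  x : Fin n → carrier
  x_mem : ∀ i, x i ∈ grade 2
  d_x : ∀ i, d (x i) = 0
  x_comm : ∀ i a, x i * a = a * x i

namespace ParamDGA

open DGA

variable {k : Type u} [CommRing k] {n : ℕ}

/-- A morphism of DGAs that preserves the chosen central cocycles. -/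
structure Hom (E F : ParamDGA k n) extends DGA.Hom E.toDGA F.toDGA where
  map_x : ∀ i, toAlgHom (E.x i) = F.x i

variable (E : ParamDGA k n) {F G : ParamDGA k n}

/-- The identity morphism. -/
def Hom.id : Hom E E := ⟨DGA.Hom.id E.toDGA, fun _ => rfl⟩

variable {E}

/-- The composition of morphisms. -/
def Hom.comp (g : Hom F G) (f : Hom E F) : Hom E G :=
  ⟨g.toHom.comp f.toHom, fun i => (congrArg _ (f.map_x i)).trans (g.map_x i)⟩

theorem sgn_x (i : Fin n) : E.sgn (E.x i) = E.x i := sgn_of_mem_even even_two (E.x_mem i)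

theorem sgn_x_pow (i : Fin n) (e : ℕ) : E.sgn (E.x i ^ e) = E.x i ^ e := by
  induction e with
  | zero => simp
  | succ e ih => rw [pow_succ, sgn_mul, ih, sgn_x]

theorem d_x_mul (i : Fin n) (a : E.carrier) : E.d (E.x i * a) = E.x i * E.d a := by
  rw [d_mul, E.d_x, zero_mul, zero_add, sgn_x]

theorem d_x_pow_mul (i : Fin n) (e : ℕ) (a : E.carrier) :
    E.d (E.x i ^ e * a) = E.x i ^ e * E.d a := by
  induction e with
  | zero => simp
  | succ e ih => rw [pow_succ', mul_assoc, d_x_mul, ih, mul_assoc]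

theorem x_pow_comm (i : Fin n) (e : ℕ) (a : E.carrier) : E.x i ^ e * a = a * E.x i ^ e :=
  (Commute.pow_left (E.x_comm i a) e).eq

theorem x_pow_mem (i : Fin n) (e : ℕ) : E.x i ^ e ∈ E.grade (2 * e) := by
  induction e with
  | zero => simpa using E.one_mem
  | succ e ih =>
    rw [pow_succ]
    have := E.mul_mem ih (E.x_mem i)
    rwa [show (2 * e : ℤ) + 2 = 2 * ((e + 1 : ℕ) : ℤ) by push_cast; ring] at this

end ParamDGA

/-- The underlying module `A ⊕ A u` of the DGA obtained from `A` by adjoining a variable `u` of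
degree `1`: the element `a + b u` has the coordinates `a` and `b`. -/
@[ext]
structure DGA.Extension {k : Type u} [CommRing k] (A : DGA k) : Type u where
  fst : A.carrier
  snd : A.carrier

namespace DGA.Extension

variable {k : Type u} [CommRing k] {A : DGA k}

/-- The coordinates of the elements of `A ⊕ A u`. -/
def equivProd (A : DGA k) : A.Extension ≃ A.carrier × A.carrier :=
  ⟨fun a => (a.fst, a.snd), fun a => ⟨a.1, a.2⟩, fun _ => rfl, fun _ => rfl⟩

instance : AddCommGroup A.Extension := (equivProd A).addCommGroup

instance : Module k A.Extension := (equivProd A).module k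

/-- The product with `u * u = 0` and `u * a = (-1) ^ |a| a * u`. -/
noncomputable instance : Mul A.Extension :=
  ⟨fun a b => ⟨a.fst * b.fst, a.fst * b.snd + a.snd * A.sgn b.fst⟩⟩

instance : One A.Extension := ⟨⟨1, 0⟩⟩

@[simp] theorem fst_zero : (0 : A.Extension).fst = 0 := rfl
@[simp] theorem snd_zero : (0 : A.Extension).snd = 0 := rfl
@[simp] theorem fst_one : (1 : A.Extension).fst = 1 := rfl
@[simp] theorem snd_one : (1 : A.Extension).snd = 0 := rfl
@[simp] theorem fst_add (a b : A.Extension) : (a + b).fst = a.fst + b.fst := rfl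
@[simp] theorem snd_add (a b : A.Extension) : (a + b).snd = a.snd + b.snd := rfl
@[simp] theorem fst_smul (r : k) (a : A.Extension) : (r • a).fst = r • a.fst := rfl
@[simp] theorem snd_smul (r : k) (a : A.Extension) : (r • a).snd = r • a.snd := rfl
@[simp] theorem fst_mul (a b : A.Extension) : (a * b).fst = a.fst * b.fst := rfl
@[simp] theorem snd_mul (a b : A.Extension) :
    (a * b).snd = a.fst * b.snd + a.snd * A.sgn b.fst := rfl

noncomputable instance : Ring A.Extension :=
  { (inferInstance : AddCommGroup A.Extension) with
    mul := (· * ·)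
    one := 1
    mul_assoc a b c := by ext <;> simp [mul_assoc, mul_add, add_mul, add_assoc]
    one_mul a := by ext <;> simp
    mul_one a := by ext <;> simp
    zero_mul a := by ext <;> simp
    mul_zero a := by ext <;> simp
    left_distrib a b c := by
      ext
      · simp [mul_add]
      · simp only [snd_mul, fst_add, snd_add, mul_add, map_add]; abel
    right_distrib a b c := by
      ext
      · simp [add_mul]
      · simp only [snd_mul, fst_add, snd_add, add_mul]; abel }

noncomputable instance : Algebra k A.Extension :=
  Algebra.ofModule (fun r a b => by ext <;> simp) (fun r a b => by ext <;> simp)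

/-- The inclusion of `A`. -/
noncomputable def inl (A : DGA k) : A.carrier →ₐ[k] A.Extension :=
  AlgHom.ofLinearMap
    { toFun := fun a => ⟨a, 0⟩
      map_add' := fun a b => by ext <;> simp
      map_smul' := fun r a => by ext <;> simp } rfl fun a b => by ext <;> simp

@[simp] theorem fst_inl (a : A.carrier) : (inl A a).fst = a := rfl
@[simp] theorem snd_inl (a : A.carrier) : (inl A a).snd = 0 := rfl

/-- The degree `i` part of `A ⊕ A u`. -/
def grade (A : DGA k) (i : ℤ) : Submodule k A.Extension where
  carrier := {a | a.fst ∈ A.grade i ∧ a.snd ∈ A.grade (i - 1)}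
  add_mem' ha hb := ⟨add_mem ha.1 hb.1, add_mem ha.2 hb.2⟩
  zero_mem' := ⟨zero_mem _, zero_mem _⟩
  smul_mem' r _ ha := ⟨Submodule.smul_mem _ r ha.1, Submodule.smul_mem _ r ha.2⟩

theorem mem_grade {i : ℤ} {a : A.Extension} :
    a ∈ grade A i ↔ a.fst ∈ A.grade i ∧ a.snd ∈ A.grade (i - 1) := Iff.rfl

theorem grade_isInternal : DirectSum.IsInternal (grade A) := by
  refine isInternal_of_projections (fun i =>
    { toFun := fun a => ⟨A.proj i a.fst, A.proj (i - 1) a.snd⟩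
      map_zero' := by ext <;> simp
      map_add' := fun a b => by ext <;> simp }) ?_ ?_ ?_
  · rintro i a ⟨h1, h2⟩
    exact Extension.ext (A.proj_of_mem h1) (A.proj_of_mem h2)
  · rintro i j hij a ⟨h1, h2⟩
    exact Extension.ext (A.proj_of_mem_ne h1 hij) (A.proj_of_mem_ne h2 (by omega))
  · rintro ⟨a, b⟩
    have h : (⟨a, b⟩ : A.Extension) = ⟨a, 0⟩ + ⟨0, b⟩ := by ext <;> simp
    rw [h]
    refine add_mem ?_ ?_
    · induction a using A.grade_induction with
      | h0 => exact zero_mem _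
      | hadd a a' ha ha' =>
        have h : (⟨a + a', 0⟩ : A.Extension) = ⟨a, 0⟩ + ⟨a', 0⟩ := by ext <;> simp
        rw [h]
        exact add_mem (ha (by ext <;> simp)) (ha' (by ext <;> simp))
      | hom i a ha => exact Submodule.mem_iSup_of_mem i ⟨ha, zero_mem _⟩
    · clear h
      induction b using A.grade_induction with
      | h0 => exact zero_mem _
      | hadd b b' hb hb' =>
        have h : (⟨0, b + b'⟩ : A.Extension) = ⟨0, b⟩ + ⟨0, b'⟩ := by ext <;> simp
        rw [h]
        exact add_mem hb hb'
      | hom i b hb =>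
        exact Submodule.mem_iSup_of_mem (i + 1) ⟨zero_mem _, by simpa using hb⟩

theorem negOnePow_smul_of_mem {i : ℤ} {a : A.Extension} (ha : a ∈ grade A i) :
    (i.negOnePow : ℤ) • a = (⟨A.sgn a.fst, -A.sgn a.snd⟩ : A.Extension) := by
  refine Extension.ext (sgn_of_mem ha.1).symm ?_
  rw [sgn_of_mem ha.2, Int.negOnePow_sub, Int.negOnePow_one]
  change (i.negOnePow : ℤ) • a.snd = _
  simp

end DGA.Extension

namespace ParamDGA

open DGA

variable {k : Type u} [CommRing k] {n : ℕ}

/-- The DGA obtained from `E` by adjoining a variable `u` of degree `1` with `d u = x i`. -/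
noncomputable def adjoin (E : ParamDGA k n) (i : Fin n) : ParamDGA k n where
  carrier := E.Extension
  grade := Extension.grade E.toDGA
  isInternal := Extension.grade_isInternal
  one_mem := ⟨E.one_mem, zero_mem _⟩
  mul_mem := by
    rintro p q a b ⟨ha, ha'⟩ ⟨hb, hb'⟩
    refine ⟨E.mul_mem ha hb, add_mem ?_ ?_⟩
    · rw [show p + q - 1 = p + (q - 1) by ring]
      exact E.mul_mem ha hb'
    · rw [show p + q - 1 = (p - 1) + q by ring]
      exact E.mul_mem ha' (sgn_mem hb)
  d :=
    { toFun := fun a => ⟨E.d a.fst + E.x i * E.sgn a.snd, E.d a.snd⟩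
      map_add' := fun a b => by
        ext
        · simp only [Extension.fst_add, Extension.snd_add, map_add, mul_add]; abel
        · simp
      map_smul' := fun r a => by ext <;> simp }
  d_mem := by
    rintro p a ⟨ha, ha'⟩
    refine ⟨add_mem (E.d_mem ha) ?_, ?_⟩
    · rw [show p + 1 = 2 + (p - 1) by ring]
      exact E.mul_mem (E.x_mem i) (sgn_mem ha')
    · rw [show p + 1 - 1 = p - 1 + 1 by ring]
      exact E.d_mem ha'
  d_d a := by
    ext
    · simp [E.d_d, d_x_mul, d_sgn]
    · simp [E.d_d]
  leibniz := by
    rintro p a b ha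
    rw [← smul_mul_assoc, Extension.negOnePow_smul_of_mem ha]
    have hx : E.sgn a.fst * (E.x i * E.sgn b.snd) = E.x i * (E.sgn a.fst * E.sgn b.snd) := by
      rw [← mul_assoc, ← E.x_comm, mul_assoc]
    have hx' : E.sgn a.snd * (E.x i * b.snd) = E.x i * (E.sgn a.snd * b.snd) := by
      rw [← mul_assoc, ← E.x_comm, mul_assoc]
    ext
    · simp only [LinearMap.coe_mk, AddHom.coe_mk, Extension.fst_mul, Extension.snd_mul,
        Extension.fst_add, d_mul, map_add, sgn_mul, sgn_sgn, mul_add, add_mul, hx, mul_assoc]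
      abel
    · simp only [LinearMap.coe_mk, AddHom.coe_mk, Extension.fst_mul, Extension.snd_mul,
        Extension.snd_add, d_mul, map_add, sgn_mul, sgn_sgn, mul_add, add_mul, hx',
        sgn_x, d_sgn, neg_mul, mul_neg, mul_assoc]
      abel
  x j := Extension.inl E.toDGA (E.x j)
  x_mem j := ⟨E.x_mem j, zero_mem _⟩
  d_x j := by ext <;> simp [E.d_x]
  x_comm j a := by ext <;> simp [E.x_comm, sgn_x]

variable (E : ParamDGA k n) (i : Fin n)

theorem adjoin_d_apply (a : E.Extension) :
    (E.adjoin i).d a = (⟨E.d a.fst + E.x i * E.sgn a.snd, E.d a.snd⟩ : E.Extension) := rfl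

theorem adjoin_sgn_apply (a : E.Extension) :
    (E.adjoin i).sgn a = (⟨E.sgn a.fst, -E.sgn a.snd⟩ : E.Extension) := by
  refine (E.adjoin i).grade_induction
    (p := fun a : E.Extension => (E.adjoin i).sgn a = (⟨E.sgn a.fst, -E.sgn a.snd⟩ : E.Extension))
    ?_ (fun a b ha hb => ?_) (fun j a ha => ?_) a
  · rw [map_zero]
    refine Extension.ext (map_zero E.sgn).symm ?_
    change (0 : E.carrier) = -E.sgn 0
    rw [map_zero, neg_zero]
  · rw [map_add, ha, hb]
    refine Extension.ext ?_ ?_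
    · exact (map_add E.sgn _ _).symm
    · exact (neg_add _ _).symm.trans (congrArg Neg.neg (map_add E.sgn _ _).symm)
  · exact (sgn_of_mem ha).trans (Extension.negOnePow_smul_of_mem ha)

theorem adjoin_proj_apply (j : ℤ) (a : E.Extension) :
    (E.adjoin i).proj j a = (⟨E.proj j a.fst, E.proj (j - 1) a.snd⟩ : E.Extension) := by
  refine (E.adjoin i).grade_induction
    (p := fun a : E.Extension =>
      (E.adjoin i).proj j a = (⟨E.proj j a.fst, E.proj (j - 1) a.snd⟩ : E.Extension))
    ?_ (fun a b ha hb => ?_) (fun l a ha => ?_) a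
  · rw [map_zero]
    exact Extension.ext (map_zero (E.proj j)).symm (map_zero (E.proj (j - 1))).symm
  · rw [map_add, ha, hb]
    refine Extension.ext ?_ ?_
    · exact (map_add (E.proj j) _ _).symm
    · exact (map_add (E.proj (j - 1)) _ _).symm
  · by_cases h : l = j
    · subst h
      rw [(E.adjoin i).proj_of_mem ha, E.proj_of_mem ha.1, E.proj_of_mem ha.2]
      rfl
    · rw [(E.adjoin i).proj_of_mem_ne ha h, E.proj_of_mem_ne ha.1 h,
        E.proj_of_mem_ne ha.2 (by omega)]
      rfl

/-- The inclusion of `E` in the DGA obtained by adjoining a variable. -/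
noncomputable def adjoinInl : Hom E (E.adjoin i) where
  toAlgHom := Extension.inl E.toDGA
  map_grade ha := ⟨ha, zero_mem _⟩
  map_d a := by
    change (⟨E.d a, 0⟩ : E.Extension) = ⟨E.d a + E.x i * E.sgn 0, E.d 0⟩
    simp
  map_x _ := rfl

/-- The adjoined variable. -/
def adjoinVar : (E.adjoin i).carrier := (⟨0, 1⟩ : E.Extension)

theorem adjoin_eq (a : E.Extension) : a = (E.adjoinInl i).toAlgHom a.fst +
    (E.adjoinInl i).toAlgHom a.snd * E.adjoinVar i := by
  change a = Extension.inl E.toDGA a.fst + Extension.inl E.toDGA a.snd * (⟨0, 1⟩ : E.Extension)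
  ext <;> simp

variable {E} {F : ParamDGA k n}

/-- Functoriality of the adjunction of a variable. -/
noncomputable def Hom.adjoin (f : Hom E F) (i : Fin n) : Hom (E.adjoin i) (F.adjoin i) where
  toAlgHom := AlgHom.ofLinearMap (A := E.Extension) (B := F.Extension)
    { toFun := fun a => ⟨f.toAlgHom a.fst, f.toAlgHom a.snd⟩
      map_add' := fun a b => by ext <;> simp
      map_smul' := fun r a =>
        Extension.ext (map_smul f.toAlgHom r a.fst) (map_smul f.toAlgHom r a.snd) }
    (by ext <;> simp) fun a b => by ext <;> simp [f.map_sgn]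
  map_grade ha := ⟨f.map_grade ha.1, f.map_grade ha.2⟩
  map_d a := by
    refine Extension.ext ?_ (f.map_d _)
    refine (map_add f.toAlgHom _ _).trans (congrArg₂ (· + ·) (f.map_d _) ?_)
    rw [map_mul, f.map_x, f.map_sgn]
    rfl
  map_x j := Extension.ext (f.map_x j) (map_zero _)

theorem Hom.adjoin_apply (f : Hom E F) (i : Fin n) (a : E.Extension) :
    (f.adjoin i).toAlgHom a = (⟨f.toAlgHom a.fst, f.toAlgHom a.snd⟩ : F.Extension) := rfl

/-- Adjoining a variable preserves quasi-isomorphisms. This is the five lemma for the extensions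
of `E u` by `E`, with elements. -/
theorem Hom.isQuasiIso_adjoin (f : Hom E F) (hf : f.IsQuasiIso) (i : Fin n) :
    (f.adjoin i).IsQuasiIso := by
  obtain ⟨hinj, hsurj⟩ := (DGA.Hom.isQuasiIso_iff _).1 hf
  refine (DGA.Hom.isQuasiIso_iff _).2 ⟨?_, ?_⟩
  · rintro (z : E.Extension) hz (w : F.Extension) hw
    obtain ⟨a, b⟩ := z
    obtain ⟨a', b'⟩ := w
    have hz1 : E.d a + E.x i * E.sgn b = 0 := congrArg Extension.fst hz
    have hz2 : E.d b = 0 := congrArg Extension.snd hz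
    have hw1 : F.d a' + F.x i * F.sgn b' = f.toAlgHom a := congrArg Extension.fst hw
    have hw2 : F.d b' = f.toAlgHom b := congrArg Extension.snd hw
    -- `b = d β`, and `b' - f β` is a cocycle, hence `f ζ` up to a coboundary
    obtain ⟨β, hβ⟩ := hinj b hz2 b' hw2
    obtain ⟨ζ, hζ, η, hη⟩ := hsurj (b' - f.toAlgHom β) (by
      rw [map_sub, hw2, ← f.map_d, hβ, sub_self])
    obtain ⟨α, hα⟩ := hinj (a - E.x i * E.sgn (β + ζ)) (by
      rw [map_sub, d_x_mul, d_sgn, map_add, hβ, hζ, add_zero, mul_neg, sub_neg_eq_add, hz1])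
      (a' + F.x i * F.sgn η) (by
        rw [map_add, d_x_mul, d_sgn, hη, map_sub f.toAlgHom, map_mul, f.map_x, f.map_sgn, ← hw1]
        simp only [map_sub, map_add, mul_neg, mul_sub, mul_add]
        abel)
    refine ⟨(⟨α, β + ζ⟩ : E.Extension), ?_⟩
    rw [adjoin_d_apply]
    exact Extension.ext (by simp [hα]) (by simp [hβ, hζ])
  · rintro (w : F.Extension) hw
    obtain ⟨a', b'⟩ := w
    have hw1 : F.d a' + F.x i * F.sgn b' = 0 := congrArg Extension.fst hw
    have hw2 : F.d b' = 0 := congrArg Extension.snd hw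
    -- lift `b'` to `β` up to a coboundary, correct it to a cocycle with the coordinates `-α` and `β`,
    -- and lift what remains of the first coordinate
    obtain ⟨β, hβ, η, hη⟩ := hsurj b' hw2
    obtain ⟨α, hα⟩ := hinj (E.x i * E.sgn β) (by
      rw [d_x_mul, d_sgn, hβ, map_zero, neg_zero, mul_zero]) (-a' - F.x i * F.sgn η) (by
        rw [map_sub, d_x_mul, d_sgn, hη, map_neg, map_mul, f.map_x, f.map_sgn,
          eq_neg_of_add_eq_zero_left hw1]
        simp only [map_sub, mul_neg, mul_sub]
        abel)
    obtain ⟨ζ, hζ, θ, hθ⟩ := hsurj (a' + f.toAlgHom α + F.x i * F.sgn η) (by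
      rw [map_add, map_add, ← f.map_d, hα, d_x_mul, d_sgn, hη, map_mul, f.map_x, f.map_sgn,
        eq_neg_of_add_eq_zero_left hw1]
      simp only [map_sub, mul_neg, mul_sub]
      abel)
    refine ⟨(⟨ζ - α, β⟩ : E.Extension), ?_, (⟨θ, η⟩ : F.Extension), ?_⟩
    · refine Extension.ext ?_ hβ
      change E.d (ζ - α) + E.x i * E.sgn β = 0
      rw [map_sub, hζ, hα, zero_sub, neg_add_cancel]
    · rw [adjoin_d_apply, Hom.adjoin_apply]
      refine Extension.ext ?_ hη
      change F.d θ + F.x i * F.sgn η = f.toAlgHom (ζ - α) - a'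
      rw [hθ, map_sub]
      abel

/-- A morphism from `E` to `T` and an element `v` of degree `1` of `T` with `d v = x i` that
squares to zero and commutes with `T` in the graded sense yield a morphism from `E.adjoin i`. -/
noncomputable def Hom.adjoinLift {T : ParamDGA k n} (f : Hom E T) (i : Fin n) (v : T.carrier)
    (hv : v ∈ T.grade 1) (hdv : T.d v = T.x i) (hvv : v * v = 0)
    (hcomm : ∀ a, v * a = T.sgn a * v) : Hom (E.adjoin i) T where
  toAlgHom := AlgHom.ofLinearMap (A := E.Extension)
    { toFun := fun a => f.toAlgHom a.fst + f.toAlgHom a.snd * v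
      map_add' := fun a b => by
        simp only [Extension.fst_add, Extension.snd_add, map_add, add_mul]
        abel
      map_smul' := fun r a => by
        change f.toAlgHom (r • a.fst) + f.toAlgHom (r • a.snd) * v = _
        rw [map_smul, map_smul, smul_mul_assoc, ← smul_add]
        rfl }
    (by simp) fun a b => by
      have h (c : T.carrier) : v * (c * v) = 0 := by
        rw [← mul_assoc, hcomm, mul_assoc, hvv, mul_zero]
      simp only [LinearMap.coe_mk, AddHom.coe_mk, Extension.fst_mul, Extension.snd_mul, map_mul,
        map_add, f.map_sgn, mul_add, add_mul, mul_assoc, h, mul_zero, add_zero, ← hcomm]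
      abel
  map_grade {p a} ha := by
    refine add_mem (f.map_grade ha.1) ?_
    have := T.mul_mem (f.map_grade ha.2) hv
    rwa [sub_add_cancel] at this
  map_d a := by
    change f.toAlgHom (E.d a.fst + E.x i * E.sgn a.snd) + f.toAlgHom (E.d a.snd) * v =
      T.d (f.toAlgHom a.fst + f.toAlgHom a.snd * v)
    rw [map_add, map_add, map_mul, f.map_x, f.map_sgn, T.d_mul, hdv, f.map_d, f.map_d, T.x_comm]
    abel
  map_x j := by
    change f.toAlgHom (E.x j) + f.toAlgHom 0 * v = _
    rw [f.map_x, map_zero, zero_mul, add_zero]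

end ParamDGA

/-! ### Truncated Koszul algebras -/

namespace ParamDGA

open DGA

variable {k : Type u} [CommRing k] {n : ℕ}

section Truncate

variable (E : ParamDGA k n) (i : Fin n) (e : ℕ)

/-- The ideal of `E.adjoin i` generated by `x i ^ (e + 1)` and `x i ^ e * u`. -/
def truncIdeal : Ideal (E.adjoin i).carrier where
  carrier := {z : E.Extension | ∃ a b, z = ⟨E.x i ^ (e + 1) * a, E.x i ^ e * b⟩}
  add_mem' := by
    rintro _ _ ⟨a, b, rfl⟩ ⟨a', b', rfl⟩
    exact ⟨a + a', b + b', Extension.ext (mul_add _ _ _).symm (mul_add _ _ _).symm⟩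
  zero_mem' := ⟨0, 0, Extension.ext (mul_zero _).symm (mul_zero _).symm⟩
  smul_mem' := by
    rintro (c : E.Extension) _ ⟨a, b, rfl⟩
    refine ⟨c.fst * a, c.fst * b + E.x i * (c.snd * E.sgn a), Extension.ext ?_ ?_⟩
    · change c.fst * (E.x i ^ (e + 1) * a) = _
      rw [← mul_assoc, ← x_pow_comm, mul_assoc]
    · change c.fst * (E.x i ^ e * b) + c.snd * E.sgn (E.x i ^ (e + 1) * a) = _
      rw [sgn_mul, sgn_x_pow, ← mul_assoc, ← mul_assoc, ← x_pow_comm, ← x_pow_comm, mul_add,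
        pow_succ]
      simp only [mul_assoc]

instance : (E.truncIdeal i e).IsTwoSided where
  mul_mem_of_left := by
    rintro _ (c : E.Extension) ⟨a, b, rfl⟩
    refine ⟨a * c.fst, E.x i * (a * c.snd) + b * E.sgn c.fst, Extension.ext ?_ ?_⟩
    · exact mul_assoc _ _ _
    · change E.x i ^ (e + 1) * a * c.snd + E.x i ^ e * b * E.sgn c.fst = _
      rw [mul_add, pow_succ]
      simp only [mul_assoc]

theorem d_mem_truncIdeal (z : E.Extension) (hz : z ∈ E.truncIdeal i e) :
    (E.adjoin i).d z ∈ E.truncIdeal i e := by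
  obtain ⟨a, b, rfl⟩ := hz
  refine ⟨E.d a + E.sgn b, E.d b, Extension.ext ?_ (d_x_pow_mul i e b)⟩
  change E.d (E.x i ^ (e + 1) * a) + E.x i * E.sgn (E.x i ^ e * b) = _
  rw [d_x_pow_mul, sgn_mul, sgn_x_pow, mul_add, pow_succ', mul_assoc, mul_assoc]

theorem proj_mem_truncIdeal (j : ℤ) (z : E.Extension) (hz : z ∈ E.truncIdeal i e) :
    (E.adjoin i).proj j z ∈ E.truncIdeal i e := by
  obtain ⟨a, b, rfl⟩ := hz
  rw [adjoin_proj_apply]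
  exact ⟨_, _, Extension.ext (proj_mul_of_mem (x_pow_mem i (e + 1)) j a)
    (proj_mul_of_mem (x_pow_mem i e) (j - 1) b)⟩

/-- The quotient of `E.adjoin i` by the ideal generated by `x i ^ (e + 1)` and `x i ^ e * u`.
For `e = 0` this is the quotient of `E` by `x i`. For `e = 1` the relations are those between the
cellular cochains of the disk. -/
noncomputable def truncate : ParamDGA k n where
  toDGA := (E.adjoin i).quotient (E.truncIdeal i e) (E.d_mem_truncIdeal i e)
    (E.proj_mem_truncIdeal i e)
  x j := Ideal.Quotient.mk _ ((E.adjoin i).x j)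
  x_mem j := ⟨_, (E.adjoin i).x_mem j, rfl⟩
  d_x j := (congrArg (Ideal.Quotient.mk (E.truncIdeal i e)) ((E.adjoin i).d_x j)).trans (map_zero _)
  x_comm j := by
    intro y
    obtain ⟨a, rfl⟩ := Ideal.Quotient.mk_surjective y
    exact congrArg (Ideal.Quotient.mk (E.truncIdeal i e)) ((E.adjoin i).x_comm j a)

/-- The projection to the truncation. -/
noncomputable def truncateMk : Hom (E.adjoin i) (E.truncate i e) where
  toHom := (E.adjoin i).quotientMk _ (E.d_mem_truncIdeal i e) (E.proj_mem_truncIdeal i e)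
  map_x _ := rfl

theorem truncateMk_surjective : Function.Surjective (E.truncateMk i e).toAlgHom :=
  quotientMk_surjective _ _ _ _

theorem truncateMk_eq_zero {z : E.Extension} :
    (E.truncateMk i e).toAlgHom z = 0 ↔ ∃ a b, z = ⟨E.x i ^ (e + 1) * a, E.x i ^ e * b⟩ :=
  quotientMk_eq_zero _ _ _ _

/-- If `x i ^ (e + 1) * a = 0` implies `x i ^ e * a = 0`, then the truncation kills an acyclic
ideal: the cocycle with the coordinates `x i ^ (e + 1) * a` and `x i ^ e * b` is the coboundary of
the element with the coordinates `0` and `x i ^ e * sgn a`. -/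
theorem isQuasiIso_truncateMk
    (h : ∀ a, E.x i ^ (e + 1) * a = 0 → E.x i ^ e * a = 0) :
    (E.truncateMk i e).IsQuasiIso := by
  refine DGA.Hom.isQuasiIso_of_surjective _ (E.truncateMk_surjective i e) ?_
  intro z hz hdz
  obtain ⟨a, b, rfl⟩ := (E.truncateMk_eq_zero i e).1 hz
  have hd : E.d (E.x i ^ (e + 1) * a) + E.x i * E.sgn (E.x i ^ e * b) = 0 :=
    congrArg Extension.fst hdz
  rw [d_x_pow_mul, sgn_mul, sgn_x_pow, ← mul_assoc, ← pow_succ', ← mul_add] at hd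
  have hd' := congrArg E.sgn (h _ hd)
  rw [sgn_mul, sgn_x_pow, map_add, sgn_sgn, map_zero, mul_add] at hd'
  refine ⟨(⟨0, E.x i ^ e * E.sgn a⟩ : E.Extension), (E.truncateMk_eq_zero i e).2
    ⟨0, E.sgn a, by rw [mul_zero]⟩, ?_⟩
  refine Extension.ext ?_ ?_
  · change E.d 0 + E.x i * E.sgn (E.x i ^ e * E.sgn a) = E.x i ^ (e + 1) * a
    rw [map_zero, zero_add, sgn_mul, sgn_x_pow, sgn_sgn, ← mul_assoc, ← pow_succ']
  · change E.d (E.x i ^ e * E.sgn a) = E.x i ^ e * b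
    rw [d_x_pow_mul, d_sgn, mul_neg]
    exact neg_eq_of_add_eq_zero_right hd'

end Truncate

/-- The Koszul algebra `E⟨u_i : i ∈ l⟩` with `d u_i = x i`. -/
noncomputable def koszul : List (Fin n) → ParamDGA k n → ParamDGA k n
  | [], E => E
  | i :: l, E => (koszul l E).adjoin i

/-- The truncated Koszul algebra, the quotient of `E⟨u_i : i ∈ l⟩` by the relations
`x i ^ (e + 1) = 0` and `x i ^ e * u_i = 0`. -/
noncomputable def truncatedKoszul (e : ℕ) : List (Fin n) → ParamDGA k n → ParamDGA k n
  | [], E => E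
  | i :: l, E => (truncatedKoszul e l E).truncate i e

/-- Koszul algebras preserve quasi-isomorphisms. -/
theorem exists_quasiIso_koszul {E F : ParamDGA k n} (f : Hom E F) (hf : f.IsQuasiIso)
    (l : List (Fin n)) : ∃ g : Hom (koszul l E) (koszul l F), g.IsQuasiIso := by
  induction l with
  | nil => exact ⟨f, hf⟩
  | cons i l ih =>
    obtain ⟨g, hg⟩ := ih
    exact ⟨g.adjoin i, g.isQuasiIso_adjoin hg i⟩

/-- `E.IsDivisible e i` provides a partial division by `x i`: an additive map `D` with
`D (x i ^ (e + 1) * a) = x i ^ e * a` that commutes with the other `x j`. Contrary to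
the injectivity of `x i ^ e * a ↦ x i ^ (e + 1) * a`, it passes to the quotients
by the other `x j`. -/
def IsDivisible (E : ParamDGA k n) (e : ℕ) (i : Fin n) : Prop :=
  ∃ D : E.carrier →+ E.carrier, (∀ a, D (E.x i ^ (e + 1) * a) = E.x i ^ e * a) ∧
    ∀ j ≠ i, ∀ a, D (E.x j * a) = E.x j * D a

theorem IsDivisible.truncate {E : ParamDGA k n} {e : ℕ} {i : Fin n} (h : E.IsDivisible e i)
    {j : Fin n} (hj : j ≠ i) : (E.truncate j e).IsDivisible e i := by
  obtain ⟨D, hD, hcomm⟩ := h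
  have hpow (m : ℕ) (a : E.carrier) : D (E.x j ^ m * a) = E.x j ^ m * D a := by
    induction m with
    | zero => simp
    | succ m ih => rw [pow_succ', mul_assoc, hcomm j hj, ih, mul_assoc]
  let D' : E.Extension →+ E.Extension :=
    { toFun := fun a => ⟨D a.fst, D a.snd⟩
      map_zero' := by ext <;> simp
      map_add' := fun a b => by ext <;> simp }
  refine ⟨quotientMap _ _ _ (E.proj_mem_truncIdeal j e) D' ?_, fun y => ?_, fun l hl y => ?_⟩
  · rintro _ ⟨a, b, rfl⟩
    exact ⟨D a, D b, Extension.ext (hpow _ a) (hpow _ b)⟩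
  · obtain ⟨a, rfl⟩ := E.truncateMk_surjective j e y
    rw [← (E.truncateMk j e).map_x, ← map_pow, ← map_pow, ← map_mul, ← map_mul,
      ← (E.adjoinInl j).map_x, ← map_pow, ← map_pow]
    refine congrArg (E.truncateMk j e).toAlgHom (Extension.ext (hD _) ?_)
    change D (E.x i ^ (e + 1) * a.snd + 0 * E.sgn a.fst) = E.x i ^ e * a.snd + 0 * E.sgn a.fst
    rw [zero_mul, add_zero, hD, add_zero]
  · obtain ⟨a, rfl⟩ := E.truncateMk_surjective j e y
    rw [← (E.truncateMk j e).map_x, ← map_mul]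
    refine congrArg (E.truncateMk j e).toAlgHom (Extension.ext (hcomm l hl _) ?_)
    change D (E.x l * a.snd + 0 * E.sgn a.fst) = E.x l * D a.snd + 0 * E.sgn (D a.fst)
    rw [zero_mul, add_zero, hcomm l hl, zero_mul, add_zero]

theorem isDivisible_truncatedKoszul {E : ParamDGA k n} {e : ℕ} {i : Fin n}
    (h : E.IsDivisible e i) {l : List (Fin n)} (hi : i ∉ l) :
    (truncatedKoszul e l E).IsDivisible e i := by
  induction l with
  | nil => exact h
  | cons j l ih =>
    rw [List.mem_cons, not_or] at hi
    exact (ih hi.2).truncate (Ne.symm hi.1)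

/-- The projection of the Koszul algebra to the truncated Koszul algebra is a
quasi-isomorphism if there are partial divisions by the `x i`. -/
theorem exists_quasiIso_truncatedKoszul {E : ParamDGA k n} {e : ℕ} (h : ∀ i, E.IsDivisible e i)
    {l : List (Fin n)} (hl : l.Nodup) :
    ∃ g : Hom (koszul l E) (truncatedKoszul e l E), g.IsQuasiIso := by
  induction l with
  | nil => exact ⟨Hom.id E, DGA.Hom.isQuasiIso_id⟩
  | cons i l ih =>
    obtain ⟨hi, hl⟩ := List.nodup_cons.1 hl
    obtain ⟨g, hg⟩ := ih hl
    obtain ⟨D, hD, -⟩ := isDivisible_truncatedKoszul (h i) hi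
    refine ⟨(truncateMk _ i e).comp (g.adjoin i),
      DGA.Hom.IsQuasiIso.comp (isQuasiIso_truncateMk _ i e fun a ha => ?_)
        (g.isQuasiIso_adjoin hg i)⟩
    rw [← hD, ha, map_zero]

/-- The elements `u i` of `T`, for `i ∈ l`, have degree `1` and satisfy, together with the `x i`, the
relations of the truncated Koszul algebra. -/
structure IsTruncated (T : ParamDGA k n) (e : ℕ) (l : List (Fin n)) (u : Fin n → T.carrier) :
    Prop where
  mem_grade : ∀ i ∈ l, u i ∈ T.grade 1
  d_eq : ∀ i ∈ l, T.d (u i) = T.x i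
  mul_self : ∀ i ∈ l, u i * u i = 0
  comm : ∀ i ∈ l, ∀ a, u i * a = T.sgn a * u i
  x_pow : ∀ i ∈ l, T.x i ^ (e + 1) = 0
  x_pow_mul : ∀ i ∈ l, T.x i ^ e * u i = 0

theorem IsTruncated.of_cons {T : ParamDGA k n} {e : ℕ} {i : Fin n} {l : List (Fin n)}
    {u : Fin n → T.carrier} (h : T.IsTruncated e (i :: l) u) : T.IsTruncated e l u where
  mem_grade j hj := h.mem_grade j (List.mem_cons_of_mem i hj)
  d_eq j hj := h.d_eq j (List.mem_cons_of_mem i hj)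
  mul_self j hj := h.mul_self j (List.mem_cons_of_mem i hj)
  comm j hj := h.comm j (List.mem_cons_of_mem i hj)
  x_pow j hj := h.x_pow j (List.mem_cons_of_mem i hj)
  x_pow_mul j hj := h.x_pow_mul j (List.mem_cons_of_mem i hj)

section TruncateRelations

variable (E : ParamDGA k n) (i : Fin n) (e : ℕ)

/-- The morphism from `E` to its truncation. -/
noncomputable def truncateInl : Hom E (E.truncate i e) := (E.truncateMk i e).comp (E.adjoinInl i)

/-- The class of the adjoined variable in the truncation. -/
noncomputable def truncateVar : (E.truncate i e).carrier :=
  (E.truncateMk i e).toAlgHom (E.adjoinVar i)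

theorem exists_truncateInl_add (y : (E.truncate i e).carrier) : ∃ a b,
    y = (E.truncateInl i e).toAlgHom a + (E.truncateInl i e).toAlgHom b * E.truncateVar i e := by
  obtain ⟨z, rfl⟩ := E.truncateMk_surjective i e y
  refine ⟨Extension.fst z, Extension.snd z, ?_⟩
  conv_lhs => rw [E.adjoin_eq i z]
  rw [map_add, map_mul]
  rfl

theorem truncateVar_isTruncated :
    (E.truncate i e).IsTruncated e [i] fun _ => E.truncateVar i e := by
  constructor <;> intro j hj <;> obtain rfl := List.mem_singleton.1 hj
  · exact (E.truncateMk j e).map_grade (i := 1) ⟨zero_mem _, E.one_mem⟩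
  · rw [← (E.truncateMk j e).map_x, truncateVar, ← DGA.Hom.map_d]
    refine congrArg (E.truncateMk j e).toAlgHom (Extension.ext ?_ E.d_one)
    change E.d 0 + E.x j * E.sgn 1 = E.x j
    rw [map_zero, zero_add, sgn_one, mul_one]
  · rw [truncateVar, ← map_mul, ← map_zero (E.truncateMk j e).toAlgHom]
    refine congrArg (E.truncateMk j e).toAlgHom (Extension.ext (mul_zero _) ?_)
    change 0 * 1 + 1 * E.sgn 0 = (0 : E.carrier)
    simp
  · intro y
    obtain ⟨a, rfl⟩ := E.truncateMk_surjective j e y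
    rw [truncateVar, ← DGA.Hom.map_sgn, ← map_mul, ← map_mul, adjoin_sgn_apply E j a]
    refine congrArg (E.truncateMk j e).toAlgHom (Extension.ext ?_ ?_)
    · exact (zero_mul _).trans (mul_zero _).symm
    · change 0 * Extension.snd a + 1 * E.sgn (Extension.fst a) =
        E.sgn (Extension.fst a) * 1 + -E.sgn (Extension.snd a) * E.sgn 0
      simp
  · rw [← (E.truncateInl j e).map_x, ← map_pow]
    refine (E.truncateMk_eq_zero j e).2 ⟨1, 0, Extension.ext ?_ ?_⟩
    · exact (mul_one _).symm
    · exact (mul_zero _).symm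
  · rw [← (E.truncateInl j e).map_x, ← map_pow, truncateVar]
    refine (map_mul (E.truncateMk j e).toAlgHom _ _).symm.trans
      ((E.truncateMk_eq_zero j e).2 ⟨0, 1, Extension.ext ?_ ?_⟩)
    · exact (mul_zero _).trans (mul_zero _).symm
    · change E.x j ^ e * 1 + 0 * E.sgn 0 = E.x j ^ e * 1
      rw [zero_mul, add_zero]

variable {E} in
theorem IsTruncated.truncate {l : List (Fin n)} {u : Fin n → E.carrier}
    (h : E.IsTruncated e l u) :
    (E.truncate i e).IsTruncated e l fun j => (E.truncateInl i e).toAlgHom (u j) := by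
  constructor <;> intro j hj
  · exact (E.truncateInl i e).map_grade (h.mem_grade j hj)
  · rw [← DGA.Hom.map_d, h.d_eq j hj, Hom.map_x]
  · rw [← map_mul, h.mul_self j hj, map_zero]
  · intro y
    obtain ⟨a, rfl⟩ := E.truncateMk_surjective i e y
    have hu : E.sgn (u j) = -u j := sgn_of_mem_odd odd_one (h.mem_grade j hj)
    rw [← DGA.Hom.map_sgn, adjoin_sgn_apply E i a]
    refine (map_mul (E.truncateMk i e).toAlgHom _ _).symm.trans (Eq.trans ?_
      (map_mul (E.truncateMk i e).toAlgHom _ _))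
    refine congrArg (E.truncateMk i e).toAlgHom (Extension.ext (h.comm j hj _) ?_)
    change u j * Extension.snd a + 0 * E.sgn (Extension.fst a) =
        E.sgn (Extension.fst a) * 0 + -E.sgn (Extension.snd a) * E.sgn (u j)
    rw [hu, neg_mul_neg, zero_mul, mul_zero, add_zero, zero_add, h.comm j hj]
  · rw [← (E.truncateInl i e).map_x, ← map_pow, h.x_pow j hj, map_zero]
  · rw [← (E.truncateInl i e).map_x, ← map_pow, ← map_mul, h.x_pow_mul j hj, map_zero]

variable {E} in
theorem exists_hom_truncate {T : ParamDGA k n} {v : Fin n → T.carrier}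
    (hv : T.IsTruncated e [i] v) (f : Hom E T) : ∃ g : Hom (E.truncate i e) T,
      (∀ a, g.toAlgHom ((E.truncateInl i e).toAlgHom a) = f.toAlgHom a) ∧
      g.toAlgHom (E.truncateVar i e) = v i := by
  have hi := List.mem_singleton_self i
  let g := f.adjoinLift i (v i) (hv.mem_grade i hi) (hv.d_eq i hi) (hv.mul_self i hi)
    (hv.comm i hi)
  have hinl (a : E.carrier) : g.toAlgHom (Extension.inl E.toDGA a) = f.toAlgHom a := by
    change f.toAlgHom a + f.toAlgHom 0 * v i = f.toAlgHom a
    rw [map_zero, zero_mul, add_zero]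
  refine ⟨⟨quotientLift _ _ _ (E.proj_mem_truncIdeal i e) g.toHom ?_, fun j => ?_⟩, hinl, ?_⟩
  · rintro _ ⟨a, b, rfl⟩
    change f.toAlgHom (E.x i ^ (e + 1) * a) + f.toAlgHom (E.x i ^ e * b) * v i = 0
    rw [map_mul, map_mul, map_pow, map_pow, f.map_x, hv.x_pow i hi, x_pow_comm, mul_assoc,
      hv.x_pow_mul i hi, zero_mul, mul_zero, add_zero]
  · exact (hinl _).trans (f.map_x j)
  · change f.toAlgHom 0 + f.toAlgHom 1 * v i = v i
    rw [map_zero, map_one, one_mul, zero_add]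

end TruncateRelations

/-- A truncated Koszul algebra contains elements `u_i` that satisfy the defining relations, is
generated by them over `E`, and is universal with respect to these relations. -/
theorem exists_isTruncated_truncatedKoszul (E : ParamDGA k n) (e : ℕ) {l : List (Fin n)}
    (hl : l.Nodup) :
    ∃ (ι : Hom E (truncatedKoszul e l E)) (u : Fin n → (truncatedKoszul e l E).carrier),
      (truncatedKoszul e l E).IsTruncated e l u ∧
      Algebra.adjoin k (Set.range ι.toAlgHom ∪ u '' {i | i ∈ l}) = ⊤ ∧
      ∀ (T : ParamDGA k n) (v : Fin n → T.carrier), T.IsTruncated e l v → ∀ f : Hom E T,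
        ∃ g : Hom (truncatedKoszul e l E) T,
          (∀ a, g.toAlgHom (ι.toAlgHom a) = f.toAlgHom a) ∧ ∀ i ∈ l, g.toAlgHom (u i) = v i := by
  induction l with
  | nil =>
    refine ⟨Hom.id E, 0, ⟨?_, ?_, ?_, ?_, ?_, ?_⟩, ?_, fun T v _ f => ⟨f, fun _ => rfl, ?_⟩⟩
    all_goals try exact fun i hi => absurd hi List.not_mem_nil
    exact eq_top_iff.2 fun a _ => Algebra.subset_adjoin (Or.inl ⟨a, rfl⟩)
  | cons i l ih =>
    obtain ⟨hi, hl⟩ := List.nodup_cons.1 hl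
    obtain ⟨ι, u, hu, hgen, huniv⟩ := ih hl
    have hne : ∀ j ∈ l, j ≠ i := fun j hj h => hi (h ▸ hj)
    let B := truncatedKoszul e l E
    let τ := B.truncateInl i e
    let u' : Fin n → (B.truncate i e).carrier :=
      fun j => if j = i then B.truncateVar i e else τ.toAlgHom (u j)
    have hui : u' i = B.truncateVar i e := if_pos rfl
    have huj : ∀ j ∈ l, u' j = τ.toAlgHom (u j) := fun j hj => if_neg (hne j hj)
    have h1 := B.truncateVar_isTruncated i e
    have h2 := hu.truncate i e
    have hmem := List.mem_singleton_self i
    refine ⟨τ.comp ι, u', ⟨?_, ?_, ?_, ?_, ?_, ?_⟩, ?_, fun T v hv f => ?_⟩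
    · refine List.forall_mem_cons.2 ⟨hui ▸ h1.mem_grade i hmem, fun j hj => ?_⟩
      exact huj j hj ▸ h2.mem_grade j hj
    · refine List.forall_mem_cons.2 ⟨hui ▸ h1.d_eq i hmem, fun j hj => ?_⟩
      exact huj j hj ▸ h2.d_eq j hj
    · refine List.forall_mem_cons.2 ⟨hui ▸ h1.mul_self i hmem, fun j hj => ?_⟩
      exact huj j hj ▸ h2.mul_self j hj
    · refine List.forall_mem_cons.2 ⟨hui ▸ h1.comm i hmem, fun j hj => ?_⟩
      exact huj j hj ▸ h2.comm j hj
    · refine List.forall_mem_cons.2 ⟨h1.x_pow i hmem, h2.x_pow⟩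
    · refine List.forall_mem_cons.2 ⟨hui ▸ h1.x_pow_mul i hmem, fun j hj => ?_⟩
      exact huj j hj ▸ h2.x_pow_mul j hj
    · let s : Set (B.truncate i e).carrier :=
        Set.range (τ.comp ι).toAlgHom ∪ u' '' {j | j ∈ i :: l}
      have hτ (a : B.carrier) : τ.toAlgHom a ∈ Algebra.adjoin k s := by
        have ha : a ∈ Algebra.adjoin k (Set.range ι.toAlgHom ∪ u '' {i | i ∈ l}) :=
          hgen ▸ Algebra.mem_top
        have ha' : τ.toAlgHom a ∈ (Algebra.adjoin k
            (Set.range ι.toAlgHom ∪ u '' {i | i ∈ l})).map τ.toAlgHom := ⟨a, ha, rfl⟩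
        rw [AlgHom.map_adjoin τ.toAlgHom] at ha'
        refine Algebra.adjoin_mono ?_ ha'
        rintro _ ⟨_, ⟨c, rfl⟩ | ⟨j, hj, rfl⟩, rfl⟩
        · exact Or.inl ⟨c, rfl⟩
        · exact Or.inr ⟨j, List.mem_cons_of_mem i hj, huj j hj⟩
      refine eq_top_iff.2 fun y _ => ?_
      obtain ⟨a, b, rfl⟩ := B.exists_truncateInl_add i e y
      exact add_mem (hτ a) (mul_mem (hτ b)
        (Algebra.subset_adjoin (Or.inr ⟨i, List.mem_cons_self, hui⟩)))
    · obtain ⟨g, hg, hg'⟩ := huniv T v hv.of_cons f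
      have hv' : T.IsTruncated e [i] v := by
        have := hv
        obtain ⟨a1, a2, a3, a4, a5, a6⟩ := this
        rw [List.forall_mem_cons] at a1 a2 a3 a4 a5 a6
        constructor <;> intro j hj <;> obtain rfl := List.mem_singleton.1 hj
        exacts [a1.1, a2.1, a3.1, a4.1, a5.1, a6.1]
      obtain ⟨g', hg1, hg2⟩ := exists_hom_truncate i e hv' g
      refine ⟨g', fun a => (hg1 _).trans (hg a), List.forall_mem_cons.2 ⟨?_, fun j hj => ?_⟩⟩
      · exact (congrArg g'.toAlgHom hui).trans hg2
      · exact (congrArg g'.toAlgHom (huj j hj)).trans ((hg1 _).trans (hg' j hj))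

end ParamDGA

/-! ### Stanley-Reisner rings -/

section MonomialIdeal

open MvPolynomial

variable {k : Type u} [CommRing k] {n : ℕ}

/-- The Stanley-Reisner ideal consists of the polynomials whose monomials are all supported on
non-faces. -/
theorem mem_stanleyReisnerIdeal_iff {K : AbstractSimplicialComplex (Fin n)}
    {f : MvPolynomial (Fin n) k} : f ∈ stanleyReisnerIdeal k K ↔
      ∀ m, coeff m f ≠ 0 → ∃ σ : Finset (Fin n), σ.Nonempty ∧ σ ∉ K ∧ ∀ i ∈ σ, m i ≠ 0 := by
  have hset : {f : MvPolynomial (Fin n) k | ∃ σ : Finset (Fin n), σ.Nonempty ∧ σ ∉ K ∧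
      f = ∏ i ∈ σ, X i} = (fun s => monomial s (1 : k)) ''
        {s | ∃ σ : Finset (Fin n), σ.Nonempty ∧ σ ∉ K ∧ s = ∑ i ∈ σ, Finsupp.single i 1} := by
    ext f
    constructor
    · rintro ⟨σ, h1, h2, rfl⟩
      exact ⟨_, ⟨σ, h1, h2, rfl⟩, monomial_sum_one _ _⟩
    · rintro ⟨_, ⟨σ, h1, h2, rfl⟩, rfl⟩
      exact ⟨σ, h1, h2, monomial_sum_one _ _⟩
  have hle (σ : Finset (Fin n)) (m : Fin n →₀ ℕ) :
      ∑ i ∈ σ, Finsupp.single i 1 ≤ m ↔ ∀ i ∈ σ, m i ≠ 0 := by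
    rw [Finsupp.le_def]
    refine forall_congr' fun i => ?_
    by_cases hi : i ∈ σ
    · simp [Finsupp.finsetSum_apply, Finsupp.single_apply, hi, Nat.one_le_iff_ne_zero]
    · simp [Finsupp.finsetSum_apply, Finsupp.single_apply, hi]
  rw [stanleyReisnerIdeal, hset, mem_ideal_span_monomial_image]
  refine forall_congr' fun m => ?_
  rw [mem_support_iff]
  refine imp_congr_right fun _ => ?_
  constructor
  · rintro ⟨_, ⟨σ, h1, h2, rfl⟩, h⟩
    exact ⟨σ, h1, h2, (hle σ m).1 h⟩
  · rintro ⟨σ, h1, h2, h⟩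
    exact ⟨_, ⟨σ, h1, h2, rfl⟩, (hle σ m).2 h⟩

/-- A property of monomials that is inherited from the monomials of `f` to those of `g` transfers
membership in the Stanley-Reisner ideal. -/
theorem mem_stanleyReisnerIdeal_of_coeff {K : AbstractSimplicialComplex (Fin n)}
    {f g : MvPolynomial (Fin n) k} (hf : f ∈ stanleyReisnerIdeal k K)
    (h : ∀ m, coeff m g ≠ 0 → ∃ m', coeff m' f ≠ 0 ∧ ∀ i, m' i ≠ 0 → m i ≠ 0) :
    g ∈ stanleyReisnerIdeal k K := by
  rw [mem_stanleyReisnerIdeal_iff] at hf ⊢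
  intro m hm
  obtain ⟨m', hm', hle⟩ := h m hm
  obtain ⟨σ, h1, h2, h3⟩ := hf m' hm'
  exact ⟨σ, h1, h2, fun i hi => hle i (h3 i hi)⟩

theorem weightedHomogeneousComponent_mem_stanleyReisnerIdeal
    {K : AbstractSimplicialComplex (Fin n)} (w : Fin n → ℤ) (i : ℤ) {f : MvPolynomial (Fin n) k}
    (hf : f ∈ stanleyReisnerIdeal k K) :
    weightedHomogeneousComponent w i f ∈ stanleyReisnerIdeal k K := by
  refine mem_stanleyReisnerIdeal_of_coeff hf fun m hm => ⟨m, fun h0 => hm ?_, fun _ h => h⟩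
  rw [coeff_weightedHomogeneousComponent, h0, ite_self]

/-- Division of a polynomial by `X i ^ p`, forgetting the monomials that are not divisible. -/
noncomputable def divXPow (i : Fin n) (p : ℕ) :
    MvPolynomial (Fin n) k →+ MvPolynomial (Fin n) k where
  toFun f := f.divMonomial (Finsupp.single i p)
  map_zero' := zero_divMonomial _
  map_add' f g := add_divMonomial f g _

theorem divXPow_X_pow_mul (i : Fin n) (p : ℕ) (f : MvPolynomial (Fin n) k) :
    divXPow i p (X i ^ p * f) = f := by
  rw [X_pow_eq_monomial]
  exact divMonomial_monomial_mul _ _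

theorem coeff_divXPow (i : Fin n) (p : ℕ) (f : MvPolynomial (Fin n) k) (m : Fin n →₀ ℕ) :
    coeff m (divXPow i p f) = coeff (Finsupp.single i p + m) f :=
  coeff_divMonomial _ _ _

theorem divXPow_X_mul {i j : Fin n} (hj : j ≠ i) (p : ℕ) (f : MvPolynomial (Fin n) k) :
    divXPow i p (X j * f) = X j * divXPow i p f := by
  ext m
  have hmem : j ∈ (Finsupp.single i p + m).support ↔ j ∈ m.support := by
    simp [Finsupp.single_eq_of_ne hj]
  simp only [coeff_divXPow, coeff_X_mul', hmem]
  split_ifs with h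
  · congr 1
    ext l
    by_cases hl : l = j
    · subst hl
      simp [Finsupp.single_eq_of_ne hj]
    · simp [Finsupp.single_eq_of_ne hl]
  · rfl

theorem X_mul_divXPow_mem_stanleyReisnerIdeal {K : AbstractSimplicialComplex (Fin n)} (i : Fin n)
    {f : MvPolynomial (Fin n) k} (hf : f ∈ stanleyReisnerIdeal k K) :
    X i * divXPow i 2 f ∈ stanleyReisnerIdeal k K := by
  refine mem_stanleyReisnerIdeal_of_coeff hf fun m hm => ?_
  rw [coeff_X_mul'] at hm
  split_ifs at hm with hi
  · rw [coeff_divXPow] at hm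
    refine ⟨_, hm, fun j hj => ?_⟩
    by_cases h : j = i
    · subst h
      exact Finsupp.mem_support_iff.1 hi
    · simpa [Finsupp.single_eq_of_ne h] using hj
  · exact absurd rfl hm

end MonomialIdeal

namespace ParamDGA

open DGA MvPolynomial

variable {k : Type u} [CommRing k] {n : ℕ}

/-- The polynomial ring, with variables of degree `2` and zero differential. -/
noncomputable def polynomial (k : Type u) [CommRing k] (n : ℕ) : ParamDGA k n where
  carrier := MvPolynomial (Fin n) k
  grade i := weightedHomogeneousSubmodule k (fun _ => (2 : ℤ)) i
  isInternal :=
    letI := weightedGradedAlgebra k (fun _ : Fin n => (2 : ℤ))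
    DirectSum.Decomposition.isInternal _
  one_mem := isWeightedHomogeneous_one k _
  mul_mem ha hb := IsWeightedHomogeneous.mul ha hb
  d := 0
  d_mem _ := zero_mem _
  d_d _ := rfl
  leibniz _ _ := by simp
  x := X
  x_mem i := isWeightedHomogeneous_X k _ i
  d_x _ := rfl
  x_comm _ _ := mul_comm _ _

theorem polynomial_proj (i : ℤ) (f : MvPolynomial (Fin n) k) :
    (polynomial k n).proj i f = weightedHomogeneousComponent (fun _ => (2 : ℤ)) i f := by
  refine (polynomial k n).grade_induction
    (p := fun f : MvPolynomial (Fin n) k => (polynomial k n).proj i f =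
      weightedHomogeneousComponent (fun _ => (2 : ℤ)) i f)
    ?_ (fun a b ha hb => ?_) (fun j a ha => ?_) f
  · exact (map_zero _).trans (map_zero _).symm
  · exact (map_add _ _ _).trans ((congrArg₂ (· + ·) ha hb).trans (map_add _ _ _).symm)
  · by_cases h : j = i
    · subst h
      exact ((polynomial k n).proj_of_mem ha).trans
        (IsWeightedHomogeneous.weightedHomogeneousComponent_same ha).symm
    · exact ((polynomial k n).proj_of_mem_ne ha h).trans
        (IsWeightedHomogeneous.weightedHomogeneousComponent_ne i ha (Ne.symm h)).symm

/-- The Stanley-Reisner ideal, as an ideal of the underlying algebra of `polynomial k n`. -/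
noncomputable abbrev faceIdeal (k : Type u) [CommRing k] (K : AbstractSimplicialComplex (Fin n)) :
    Ideal (polynomial k n).carrier :=
  stanleyReisnerIdeal k K

instance (K : AbstractSimplicialComplex (Fin n)) : (faceIdeal k K).IsTwoSided :=
  inferInstanceAs (stanleyReisnerIdeal k K).IsTwoSided

theorem proj_mem_faceIdeal (K : AbstractSimplicialComplex (Fin n)) (i : ℤ)
    (f : (polynomial k n).carrier) (hf : f ∈ faceIdeal k K) :
    (polynomial k n).proj i f ∈ faceIdeal k K := by
  rw [polynomial_proj i f]
  exact weightedHomogeneousComponent_mem_stanleyReisnerIdeal _ i hf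

/-- The Stanley-Reisner ring, with variables of degree `2` and zero differential. -/
noncomputable def stanleyReisner (k : Type u) [CommRing k] (K : AbstractSimplicialComplex (Fin n)) :
    ParamDGA k n where
  toDGA := (polynomial k n).quotient (faceIdeal k K) (fun _ _ => zero_mem _) (proj_mem_faceIdeal K)
  x j := Ideal.Quotient.mk (faceIdeal k K) (X j)
  x_mem j := ⟨_, (polynomial k n).x_mem j, rfl⟩
  d_x j := rfl
  x_comm j y := by
    obtain ⟨f, rfl⟩ := Ideal.Quotient.mk_surjective y
    exact congrArg (Ideal.Quotient.mk (faceIdeal k K)) ((polynomial k n).x_comm j f)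

/-- The projection of the polynomial ring to the Stanley-Reisner ring. -/
noncomputable def stanleyReisnerMk (k : Type u) [CommRing k]
    (K : AbstractSimplicialComplex (Fin n)) : Hom (polynomial k n) (stanleyReisner k K) where
  toHom := (polynomial k n).quotientMk (faceIdeal k K) (fun _ _ => zero_mem _)
    (proj_mem_faceIdeal K)
  map_x _ := rfl

theorem stanleyReisnerMk_surjective (K : AbstractSimplicialComplex (Fin n)) :
    Function.Surjective (stanleyReisnerMk k K).toAlgHom :=
  Ideal.Quotient.mk_surjective

theorem stanleyReisner_d (K : AbstractSimplicialComplex (Fin n))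
    (y : (stanleyReisner k K).carrier) :
    (stanleyReisner k K).d y = 0 := by
  obtain ⟨f, rfl⟩ := stanleyReisnerMk_surjective K y
  exact map_zero (Ideal.Quotient.mk (faceIdeal k K))

/-- Dividing by `X i ^ 2` and multiplying by `X i` maps every monomial to zero or to a monomial
with the same support, so it passes to the Stanley-Reisner ring. -/
theorem isDivisible_stanleyReisner (K : AbstractSimplicialComplex (Fin n)) (i : Fin n) :
    (stanleyReisner k K).IsDivisible 1 i := by
  let D : MvPolynomial (Fin n) k →+ MvPolynomial (Fin n) k :=
    (AddMonoidHom.mulLeft (X i)).comp (divXPow i 2)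
  refine ⟨quotientMap (A := (polynomial k n).toDGA) (faceIdeal k K) (fun _ _ => zero_mem _)
    (proj_mem_faceIdeal K) D ?_, fun y => ?_, fun j hj y => ?_⟩
  · exact fun f hf => X_mul_divXPow_mem_stanleyReisnerIdeal i hf
  · obtain ⟨(f : MvPolynomial (Fin n) k), rfl⟩ := stanleyReisnerMk_surjective K y
    refine congrArg (Ideal.Quotient.mk (faceIdeal k K)) ?_
    change X i * divXPow i 2 (X i ^ 2 * f) = X i ^ 1 * f
    rw [divXPow_X_pow_mul, pow_one]
  · obtain ⟨(f : MvPolynomial (Fin n) k), rfl⟩ := stanleyReisnerMk_surjective K y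
    refine congrArg (Ideal.Quotient.mk (faceIdeal k K)) ?_
    change X i * divXPow i 2 (X j * f) = X j * (X i * divXPow i 2 f)
    rw [divXPow_X_mul hj, mul_left_comm]

variable (T : ParamDGA k n)

/-- The structure homomorphism of `T` as an algebra over the polynomial ring. -/
noncomputable def polyMap : MvPolynomial (Fin n) k →ₐ[k] T.carrier :=
  (Subalgebra.center k T.carrier).val.comp
    (aeval fun i => ⟨T.x i, Subalgebra.mem_center_iff.2 fun a => (T.x_comm i a).symm⟩)

@[simp]
theorem polyMap_X (i : Fin n) : T.polyMap (X i) = T.x i := by simp [polyMap]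

theorem polyMap_comm (f : MvPolynomial (Fin n) k) (a : T.carrier) :
    T.polyMap f * a = a * T.polyMap f :=
  (Subalgebra.mem_center_iff.1 (Subtype.prop (aeval (R := k) (S₁ := Subalgebra.center k T.carrier)
    (fun i => ⟨T.x i, Subalgebra.mem_center_iff.2 fun a => (T.x_comm i a).symm⟩) f)) a).symm

variable {T} in
theorem Hom.map_polyMap {E : ParamDGA k n} (g : Hom E T) (f : MvPolynomial (Fin n) k) :
    g.toAlgHom (E.polyMap f) = T.polyMap f := by
  have : g.toAlgHom.comp E.polyMap = T.polyMap := by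
    ext i
    simp [g.map_x]
  rw [← this]
  rfl

theorem polyMap_monomial_mem (m : Fin n →₀ ℕ) :
    T.polyMap (monomial m 1) ∈ T.grade (Finsupp.weight (fun _ => (2 : ℤ)) m) := by
  induction m using Finsupp.induction_linear with
  | zero => simpa using T.one_mem
  | add f g hf hg =>
    rw [← one_mul (1 : k), ← monomial_mul, map_mul, map_add]
    exact T.mul_mem hf hg
  | single i p =>
    rw [← X_pow_eq_monomial, map_pow, polyMap_X, Finsupp.weight_single]
    simpa [mul_comm] using x_pow_mem (E := T) i p

theorem polyMap_mem {f : MvPolynomial (Fin n) k} {i : ℤ}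
    (hf : f.IsWeightedHomogeneous (fun _ => (2 : ℤ)) i) : T.polyMap f ∈ T.grade i := by
  rw [f.as_sum, map_sum]
  refine sum_mem fun m hm => ?_
  rw [← mul_one (coeff m f), ← smul_eq_mul, ← smul_monomial, map_smul,
    ← hf (mem_support_iff.1 hm)]
  exact Submodule.smul_mem _ _ (T.polyMap_monomial_mem m)

theorem d_polyMap (f : MvPolynomial (Fin n) k) : T.d (T.polyMap f) = 0 := by
  induction f using MvPolynomial.induction_on with
  | C a =>
    rw [← algebraMap_eq, AlgHom.commutes, Algebra.algebraMap_eq_smul_one, map_smul, T.d_one,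
      smul_zero]
  | add f g hf hg => rw [map_add, map_add, hf, hg, add_zero]
  | mul_X f i hf => rw [map_mul, polyMap_X, ← T.x_comm, d_x_mul, hf, mul_zero]

/-- The polynomial ring is initial among the DGAs with central cocycles. -/
noncomputable def polyHom : Hom (polynomial k n) T where
  toAlgHom := T.polyMap
  map_grade hf := T.polyMap_mem hf
  map_d f := (map_zero T.polyMap).trans (T.d_polyMap f).symm
  map_x i := T.polyMap_X i

/-- The Stanley-Reisner ring is initial among the DGAs with central cocycles `x i` whose products
over the non-faces vanish. -/
theorem exists_hom_stanleyReisner {K : AbstractSimplicialComplex (Fin n)}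
    (hT : ∀ σ : Finset (Fin n), σ.Nonempty → σ ∉ K → T.polyMap (∏ i ∈ σ, X i) = 0) :
    Nonempty (Hom (stanleyReisner k K) T) := by
  have hker : stanleyReisnerIdeal k K ≤ RingHom.ker T.polyMap := by
    refine Ideal.span_le.2 ?_
    rintro _ ⟨σ, h1, h2, rfl⟩
    exact hT σ h1 h2
  exact ⟨⟨quotientLift (A := (polynomial k n).toDGA) (faceIdeal k K) (fun _ _ => zero_mem _)
    (proj_mem_faceIdeal K) T.polyHom.toHom fun f hf => hker hf, fun i => T.polyHom.map_x i⟩⟩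

theorem stanleyReisner_polyMap_eq (K : AbstractSimplicialComplex (Fin n))
    (f : MvPolynomial (Fin n) k) :
    (stanleyReisner k K).polyMap f = (stanleyReisnerMk k K).toAlgHom f := by
  rw [← (stanleyReisnerMk k K).map_polyMap]
  congr 1
  have : (polynomial k n).polyMap = AlgHom.id k (MvPolynomial (Fin n) k) := by
    refine MvPolynomial.algHom_ext fun i => ?_
    exact polyMap_X _ i
  rw [this]
  rfl

theorem stanleyReisner_polyMap_surjective (K : AbstractSimplicialComplex (Fin n)) :
    Function.Surjective (stanleyReisner k K).polyMap := fun y => by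
  obtain ⟨f, rfl⟩ := stanleyReisnerMk_surjective K y
  exact ⟨f, stanleyReisner_polyMap_eq K f⟩

theorem stanleyReisner_polyMap_eq_zero {K : AbstractSimplicialComplex (Fin n)}
    {σ : Finset (Fin n)} (h : σ.Nonempty) (hσ : σ ∉ K) :
    (stanleyReisner k K).polyMap (∏ i ∈ σ, X i) = 0 := by
  rw [stanleyReisner_polyMap_eq]
  exact Ideal.Quotient.eq_zero_iff_mem.2 (Ideal.subset_span ⟨σ, h, hσ, rfl⟩)

end ParamDGA

/-! ### Generators of the cellular cochain algebra -/

namespace CellularCochain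

open MomentAngleCell

variable {n : ℕ} {k : Type u} [CommRing k] {K : AbstractSimplicialComplex (Fin n)}

variable (k K) in
/-- The cochain dual to the product cell with the factors `g`. It is zero if `g` is not a cell of the
moment-angle complex. -/
def indicator (g : Fin n → Fin 3) : CellularCochain k K := ⟨fun c => if c.factor = g then 1 else 0⟩

theorem indicator_apply (g : Fin n → Fin 3) (c : MomentAngleCell K) :
    indicator k K g c = if c.factor = g then 1 else 0 := rfl

theorem indicator_zero : indicator k K 0 = 1 := by
  ext c
  rw [indicator_apply, one_apply]
  refine if_congr ?_ rfl rfl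
  rw [support_eq_empty_iff, funext_iff]
  rfl

theorem indicator_mem_grade {g : Fin n → Fin 3} {i : ℤ} (h : ((∑ j, (g j : ℕ) : ℕ) : ℤ) = i) :
    indicator k K g ∈ grade k K i := by
  intro c hc
  rw [indicator_apply] at hc
  have hg : c.factor = g := by
    by_contra h0
    exact hc (if_neg h0)
  rw [← h, ← hg]
  rfl

/-- A cell whose `2`-dimensional factors form a non-face does not occur. -/
theorem indicator_eq_zero {g : Fin n → Fin 3}
    (h : (Finset.univ.filter fun i => g i = 2).Nonempty)
    (hK : (Finset.univ.filter fun i => g i = 2) ∉ K) : indicator k K g = 0 := by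
  ext c
  rw [indicator_apply, if_neg, zero_apply]
  rintro rfl
  rcases (pi_subset_iff c.factor).1 c.subset with h' | h'
  · exact h.ne_empty h'
  · exact hK h'

variable (k K) in
/-- The cochain dual to the product of the `a`-dimensional cell in the `i`-th factor with
`0`-cells. -/
def gen (i : Fin n) (a : Fin 3) : CellularCochain k K := indicator k K (Pi.single i a)

theorem gen_mem_grade (i : Fin n) (a : Fin 3) : gen k K i a ∈ grade k K (a : ℕ) := by
  refine indicator_mem_grade ?_
  rw [Finset.sum_eq_single i]
  · simp
  · intro j _ hj
    simp [Pi.single_eq_of_ne hj]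
  · simp

theorem gen_mul_apply (i : Fin n) {a : Fin 3} (ha : a ≠ 0) (f : CellularCochain k K)
    (c : MomentAngleCell K) : (gen k K i a * f) c =
      if c.factor i = a then (-1) ^ c.inversions {i} * f (c.restrict {i}ᶜ) else 0 := by
  have key (s : Finset (Fin n)) (hs : s ⊆ c.support)
      (h : (c.restrict s).factor = Pi.single i a) : s = {i} ∧ c.factor i = a := by
    have hi := congrFun h i
    rw [restrict_apply, Pi.single_eq_same] at hi
    have his : i ∈ s := by
      by_contra his
      exact ha (by rw [← hi, if_neg his])
    refine ⟨Finset.eq_singleton_iff_unique_mem.2 ⟨his, fun j hj => ?_⟩, by rwa [if_pos his] at hi⟩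
    by_contra hji
    have hj' := congrFun h j
    rw [restrict_apply, if_pos hj, Pi.single_eq_of_ne hji] at hj'
    exact mem_support.1 (hs hj) hj'
  rw [mul_apply]
  split_ifs with hc
  · rw [Finset.sum_eq_single {i}]
    · have : (c.restrict {i}).factor = Pi.single i a := by
        funext j
        rw [restrict_apply]
        by_cases hj : j = i
        · subst hj; simp [hc]
        · simp [hj]
      rw [gen, indicator_apply, if_pos this, one_mul]
    · intro s hs hne
      rw [gen, indicator_apply, if_neg, zero_mul, mul_zero]
      exact fun h => hne (key s (Finset.mem_powerset.1 hs) h).1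
    · intro h
      refine absurd (Finset.mem_powerset.2 (Finset.singleton_subset_iff.2 ?_)) h
      exact mem_support.2 (hc ▸ ha)
  · refine Finset.sum_eq_zero fun s hs => ?_
    rw [gen, indicator_apply, if_neg, zero_mul, mul_zero]
    exact fun h => hc (key s (Finset.mem_powerset.1 hs) h).2

theorem mul_gen_apply (i : Fin n) {a : Fin 3} (ha : a ≠ 0) (f : CellularCochain k K)
    (c : MomentAngleCell K) : (f * gen k K i a) c =
      if c.factor i = a then (-1) ^ c.inversions (c.support.erase i) * f (c.restrict {i}ᶜ)
      else 0 := by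
  have key (s : Finset (Fin n)) (hs : s ⊆ c.support)
      (h : (c.restrict sᶜ).factor = Pi.single i a) : s = c.support.erase i ∧ c.factor i = a := by
    have hi := congrFun h i
    rw [restrict_apply, Pi.single_eq_same] at hi
    have his : i ∉ s := by
      intro his
      exact ha (by rw [← hi, if_neg (by simpa using his)])
    refine ⟨Finset.Subset.antisymm (fun j hj => Finset.mem_erase.2
      ⟨fun h => his (h ▸ hj), hs hj⟩) fun j hj => ?_, by rwa [if_pos (by simpa using his)] at hi⟩
    by_contra hjs
    obtain ⟨hji, hj⟩ := Finset.mem_erase.1 hj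
    have hj' := congrFun h j
    rw [restrict_apply, if_pos (by simpa using hjs), Pi.single_eq_of_ne hji] at hj'
    exact mem_support.1 hj hj'
  rw [mul_apply]
  split_ifs with hc
  · rw [Finset.sum_eq_single (c.support.erase i)]
    · have h1 : (c.restrict (c.support.erase i)ᶜ).factor = Pi.single i a := by
        funext j
        rw [restrict_apply]
        by_cases hj : j = i
        · subst hj; simp [hc]
        · by_cases h0 : c.factor j = 0 <;> simp [hj, h0, mem_support]
      have h2 : c.restrict (c.support.erase i) = c.restrict {i}ᶜ :=
        c.restrict_congr (by ext j; simp; tauto)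
      rw [gen, indicator_apply, if_pos h1, mul_one, h2]
    · intro s hs hne
      rw [gen, indicator_apply, if_neg, mul_zero, mul_zero]
      exact fun h => hne (key s (Finset.mem_powerset.1 hs) h).1
    · intro h
      exact absurd (Finset.mem_powerset.2 (Finset.erase_subset _ _)) h
  · refine Finset.sum_eq_zero fun s hs => ?_
    rw [gen, indicator_apply, if_neg, mul_zero, mul_zero]
    exact fun h => hc (key s (Finset.mem_powerset.1 hs) h).2

theorem gen_mul_gen (i : Fin n) {a b : Fin 3} (ha : a ≠ 0) (hb : b ≠ 0) :
    gen k K i a * gen k K i b = 0 := by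
  ext c
  rw [gen_mul_apply i ha, zero_apply]
  split_ifs with hc
  · rw [gen, indicator_apply, if_neg, mul_zero]
    intro h
    have := congrFun h i
    rw [restrict_apply, if_neg (by simp), Pi.single_eq_same] at this
    exact hb this.symm
  · rfl

theorem gen_two_comm (i : Fin n) (f : CellularCochain k K) :
    gen k K i 2 * f = f * gen k K i 2 := by
  ext c
  rw [gen_mul_apply i (by decide), mul_gen_apply i (by decide)]
  split_ifs with hc
  · have h1 : c.inversions {i} = 0 := by
      rw [inversions, Finset.card_eq_zero, Finset.filter_eq_empty_iff]
      rintro p - ⟨-, h, -, h', -⟩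
      rw [Finset.mem_singleton.1 h, hc] at h'
      exact absurd h' (by decide)
    have h2 : c.inversions (c.support.erase i) = 0 := by
      rw [inversions, Finset.card_eq_zero, Finset.filter_eq_empty_iff]
      rintro p - ⟨-, -, h, -, h'⟩
      have hp : p.2 = i := by
        by_contra hp
        exact h (Finset.mem_erase.2 ⟨hp, mem_support.2 (by rw [h']; decide)⟩)
      rw [hp, hc] at h'
      exact absurd h' (by decide)
    rw [h1, h2]
  · rfl

/-- The sign involution of the cellular cochain algebra. -/
def signed (f : CellularCochain k K) : CellularCochain k K := ⟨fun c => (-1) ^ c.dim * f c⟩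

theorem signed_apply (f : CellularCochain k K) (c : MomentAngleCell K) :
    signed f c = (-1) ^ c.dim * f c := rfl

theorem sgn_eq_signed (f : CellularCochain k K) :
    (cellularCochainAlgebra k K).sgn f = signed f := by
  refine (cellularCochainAlgebra k K).grade_induction
    (p := fun f : CellularCochain k K => (cellularCochainAlgebra k K).sgn f = signed f)
    ?_ (fun a b ha hb => ?_)
    (fun i (a : CellularCochain k K) (ha : a ∈ grade k K i) => ?_) f
  · refine (map_zero _).trans (ext_apply fun c => ?_)
    exact (mul_zero _).symm
  · refine (map_add _ _ _).trans ((congrArg₂ (· + ·) ha hb).trans (ext_apply fun c => ?_))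
    exact (mul_add _ _ _).symm
  · refine (DGA.sgn_of_mem (A := cellularCochainAlgebra k K) ha).trans (ext_apply fun c => ?_)
    have hz : ∀ (z : ℤ) (x : CellularCochain k K), (z • x) c = z * x c := fun z x => by
      change z • (x c) = _
      simp
    refine (hz _ a).trans ?_
    rw [signed_apply]
    by_cases h0 : a c = 0
    · rw [h0, mul_zero, mul_zero]
    · rw [← ha c h0, Int.negOnePow_def, zpow_natCast]
      push_cast
      rfl

/-- The `1`-dimensional factors in front of the `i`-th factor and those behind it are all the
others. -/
theorem inversions_singleton_add (c : MomentAngleCell K) {i : Fin n} (hi : c.factor i = 1) :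
    c.inversions {i} + c.inversions (c.support.erase i) =
      (Finset.univ.filter fun j => (c.restrict {i}ᶜ).factor j = 1).card := by
  have h1 : c.inversions {i} = ∑ j, if j < i ∧ c.factor j = 1 then 1 else 0 := by
    simp only [inversions, Finset.card_filter, Fintype.sum_prod_type]
    rw [Finset.sum_eq_single i]
    · refine Finset.sum_congr rfl fun j _ => if_congr ?_ rfl rfl
      simp only [Finset.mem_singleton, hi, true_and]
      exact ⟨fun h => ⟨h.1, h.2.2⟩, fun h => ⟨h.1, h.1.ne, h.2⟩⟩
    · intro j _ hj
      simp [hj]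
    · simp
  have h2 : c.inversions (c.support.erase i) = ∑ j, if i < j ∧ c.factor j = 1 then 1 else 0 := by
    simp only [inversions, Finset.card_filter, Fintype.sum_prod_type_right]
    rw [Finset.sum_eq_single i]
    · refine Finset.sum_congr rfl fun j _ => if_congr ?_ rfl rfl
      simp only [Finset.mem_erase, mem_support]
      constructor
      · exact fun h => ⟨h.1, h.2.2.2.1⟩
      · exact fun h => ⟨h.1, ⟨h.1.ne', by rw [h.2]; decide⟩, fun h' => h'.1 rfl, h.2, hi⟩
    · intro j _ hj
      refine Finset.sum_eq_zero fun l _ => if_neg ?_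
      rintro ⟨-, -, h, -, h'⟩
      exact h (Finset.mem_erase.2 ⟨hj, mem_support.2 (by rw [h']; decide)⟩)
    · simp
  rw [h1, h2, Finset.card_filter, ← Finset.sum_add_distrib]
  refine Finset.sum_congr rfl fun j _ => ?_
  rw [restrict_apply]
  rcases lt_trichotomy j i with h | h | h
  · simp [h, h.not_gt, h.ne]
  · simp [h]
  · simp [h, h.not_gt, h.ne']

theorem gen_one_comm (i : Fin n) (f : CellularCochain k K) :
    gen k K i 1 * f = signed f * gen k K i 1 := by
  ext c
  rw [gen_mul_apply i (by decide), mul_gen_apply i (by decide), signed_apply]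
  split_ifs with hc
  · obtain ⟨m, hm⟩ := (c.restrict {i}ᶜ).dim_parity
    have hsq : ((-1 : k) ^ c.inversions (c.support.erase i)) ^ 2 = 1 := by
      rw [← pow_mul, mul_comm, pow_mul]; simp
    rw [hm, ← inversions_singleton_add c hc, pow_add, pow_add, pow_mul]
    simp only [even_two, Even.neg_pow, one_pow, mul_one]
    linear_combination (-(-1) ^ c.inversions {i} * f (c.restrict {i}ᶜ)) * hsq
  · rfl

theorem d_gen_one (i : Fin n) : d (gen k K i 1) = gen k K i 2 := by
  ext c
  have key (j : Fin n) (hj : c.factor j = 2) (h : (c.face j).factor = Pi.single i 1) :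
      c.factor = Pi.single i 2 := by
    have hji : j = i := by
      by_contra hji
      have := congrFun h j
      rw [face_apply, if_pos ⟨rfl, hj⟩, Pi.single_eq_of_ne hji] at this
      exact absurd this (by decide)
    subst hji
    funext l
    by_cases hl : l = j
    · subst hl; rw [hj, Pi.single_eq_same]
    · have := congrFun h l
      rw [face_apply, if_neg fun h => hl h.1, Pi.single_eq_of_ne hl] at this
      rw [this, Pi.single_eq_of_ne hl]
  rw [d_apply, gen, gen, indicator_apply]
  split_ifs with hc
  · have hi : c.factor i = 2 := by rw [hc, Pi.single_eq_same]
    have hne : ∀ j, j ≠ i → c.factor j = 0 := fun j hj => by rw [hc, Pi.single_eq_of_ne hj]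
    rw [Finset.sum_eq_single i]
    · have h1 : c.onesBefore i = 0 := by
        rw [onesBefore, Finset.card_eq_zero, Finset.filter_eq_empty_iff]
        rintro j - ⟨hj, hj'⟩
        rw [hne j hj.ne] at hj'
        exact absurd hj' (by decide)
      have h2 : (c.face i).factor = Pi.single i 1 := by
        funext j
        rw [face_apply]
        by_cases hj : j = i
        · subst hj; simp [hi]
        · simp [hj, hne j hj]
      rw [h1, indicator_apply, if_pos h2, pow_zero, one_mul]
    · intro j hj hji
      rw [Finset.mem_filter, hne j hji] at hj
      exact absurd hj.2 (by decide)
    · simp [hi]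
  · refine Finset.sum_eq_zero fun j hj => ?_
    rw [indicator_apply, if_neg fun h => hc (key j (Finset.mem_filter.1 hj).2 h), mul_zero]

/-- The sign in the product is trivial if there is no `1`-dimensional factor in front of a
`1`-dimensional new factor. -/
theorem gen_mul_indicator {i : Fin n} {a : Fin 3} (ha : a ≠ 0) {g : Fin n → Fin 3} (hg : g i = 0)
    (h : a = 1 → ∀ j < i, g j ≠ 1) :
    gen k K i a * indicator k K g = indicator k K (Function.update g i a) := by
  ext c
  have key : c.factor = Function.update g i a ↔
      c.factor i = a ∧ (c.restrict {i}ᶜ).factor = g := by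
    constructor
    · intro hc
      refine ⟨by rw [hc, Function.update_self], funext fun j => ?_⟩
      rw [restrict_apply, hc]
      by_cases hj : j = i
      · subst hj; simp [hg]
      · simp [hj]
    · rintro ⟨h1, h2⟩
      funext j
      by_cases hj : j = i
      · subst hj; rw [h1, Function.update_self]
      · have := congrFun h2 j
        rw [restrict_apply, if_pos (by simpa using hj)] at this
        rw [this, Function.update_of_ne hj]
  rw [gen_mul_apply i ha, indicator_apply, indicator_apply]
  by_cases hc : c.factor i = a
  · by_cases hc' : (c.restrict {i}ᶜ).factor = g
    · have h0 : c.inversions {i} = 0 := by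
        rw [inversions, Finset.card_eq_zero, Finset.filter_eq_empty_iff]
        rintro p - ⟨hlt, h1, -, h2, h3⟩
        rw [Finset.mem_singleton] at h1
        rw [h1] at hlt h2
        refine h (hc.symm.trans h2) p.2 hlt ?_
        rw [← hc', restrict_apply, if_pos (by simpa using hlt.ne), h3]
      rw [if_pos hc, if_pos hc', if_pos (key.2 ⟨hc, hc'⟩), h0, pow_zero, one_mul]
    · rw [if_pos hc, if_neg hc', if_neg fun h => hc' (key.1 h).2, mul_zero]
  · rw [if_neg hc, if_neg fun h => hc (key.1 h).1]

end CellularCochain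

/-- The cellular cochain algebra, with the cochains dual to the `2`-cells of the disks as central
cocycles. -/
noncomputable def cellularParamDGA {n : ℕ} (k : Type u) [CommRing k]
    (K : AbstractSimplicialComplex (Fin n)) : ParamDGA k n where
  toDGA := cellularCochainAlgebra k K
  x i := CellularCochain.gen k K i 2
  x_mem i := CellularCochain.gen_mem_grade i 2
  d_x i := by
    refine (congrArg CellularCochain.d (CellularCochain.d_gen_one i).symm).trans ?_
    exact CellularCochain.d_d _
  x_comm i f := CellularCochain.gen_two_comm i f

namespace CellularCochain

open MomentAngleCell MvPolynomial

variable {n : ℕ} {k : Type u} [CommRing k] {K : AbstractSimplicialComplex (Fin n)}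

theorem gen_one_isTruncated (l : List (Fin n)) :
    (cellularParamDGA k K).IsTruncated 1 l fun i => gen k K i 1 where
  mem_grade i _ := gen_mem_grade i 1
  d_eq i _ := d_gen_one i
  mul_self i _ := gen_mul_gen i (by decide) (by decide)
  comm i _ f := (gen_one_comm i f).trans
    (congrArg (· * gen k K i 1) (sgn_eq_signed f).symm)
  x_pow i _ := (pow_two _).trans (gen_mul_gen i (by decide) (by decide))
  x_pow_mul i _ := (congrArg (· * (gen k K i 1)) (pow_one (gen k K i 2))).trans
    (gen_mul_gen i (by decide) (by decide))

theorem polyMap_prod_X (σ : Finset (Fin n)) : (cellularParamDGA k K).polyMap (∏ i ∈ σ, X i) =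
    indicator k K fun i => if i ∈ σ then 2 else 0 := by
  induction σ using Finset.induction_on with
  | empty =>
    rw [Finset.prod_empty, map_one]
    exact (indicator_zero (k := k) (K := K)).symm
  | insert i σ hi ih =>
    rw [Finset.prod_insert hi, map_mul, ParamDGA.polyMap_X, ih]
    refine (gen_mul_indicator (k := k) (K := K) (i := i) (a := 2) (by decide)
      (if_neg hi) fun h => absurd h (by decide)).trans ?_
    congr 1
    funext j
    by_cases hj : j = i
    · subst hj; simp
    · simp [hj]

theorem polyMap_prod_X_eq_zero {σ : Finset (Fin n)} (h : σ.Nonempty) (hσ : σ ∉ K) :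
    (cellularParamDGA k K).polyMap (∏ i ∈ σ, X i) = 0 := by
  have : (Finset.univ.filter fun i => (if i ∈ σ then (2 : Fin 3) else 0) = 2) = σ := by
    ext i
    by_cases hi : i ∈ σ <;> simp [hi]
  rw [polyMap_prod_X]
  exact indicator_eq_zero (by rwa [this]) (by rwa [this])

/-- The ordered product of generators is the cochain dual to a product cell. -/
theorem prod_gen {l : List (Fin n)} (hl : l.Pairwise (· < ·)) (g : Fin n → Fin 3) :
    (l.map fun i => if g i = 0 then 1 else gen k K i (g i)).prod =
      indicator k K fun i => if i ∈ l then g i else 0 := by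
  induction l with
  | nil => exact indicator_zero.symm
  | cons i l ih =>
    obtain ⟨hi, hl⟩ := List.pairwise_cons.1 hl
    have hil : i ∉ l := fun h => lt_irrefl i (hi i h)
    rw [List.map_cons, List.prod_cons, ih hl]
    split_ifs with h0
    · rw [one_mul]
      congr 1
      funext j
      by_cases hj : j = i
      · subst hj; simp [hil, h0]
      · simp [hj]
    · rw [gen_mul_indicator (i := i) h0 (if_neg hil)]
      · congr 1
        funext j
        by_cases hj : j = i
        · subst hj; simp
        · simp [hj]
      · intro _ j hj
        rw [if_neg fun h => (hi j h).not_gt hj]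
        decide

end CellularCochain

/-! ### The truncated Koszul algebra of the Stanley-Reisner ring -/

namespace ParamDGA

open MvPolynomial DGA

variable {k : Type u} [CommRing k] {n : ℕ} (T : ParamDGA k n) (u : Fin n → T.carrier)

/-- The element of `T` that corresponds to the `a`-dimensional cell of the `i`-th disk. -/
def letter (i : Fin n) (a : Fin 3) : T.carrier := if a = 0 then 1 else if a = 1 then u i else T.x i

/-- The ordered product of letters that corresponds to a product cell. -/
def word (l : List (Fin n)) (h : Fin n → Fin 3) : T.carrier :=
  (l.map fun i => T.letter u i (h i)).prod

variable {T u}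

@[simp] theorem letter_zero (i : Fin n) : T.letter u i 0 = 1 := rfl
@[simp] theorem letter_one (i : Fin n) : T.letter u i 1 = u i := rfl
@[simp] theorem letter_two (i : Fin n) : T.letter u i 2 = T.x i := rfl

theorem word_cons (i : Fin n) (l : List (Fin n)) (h : Fin n → Fin 3) :
    T.word u (i :: l) h = T.letter u i (h i) * T.word u l h := List.prod_cons

theorem word_congr {l : List (Fin n)} {h h' : Fin n → Fin 3} (hh : ∀ i ∈ l, h i = h' i) :
    T.word u l h = T.word u l h' :=
  congrArg List.prod (List.map_congr_left fun i hi => by rw [hh i hi])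

theorem word_cons_update {i : Fin n} {l : List (Fin n)} (hi : i ∉ l) (h : Fin n → Fin 3)
    (a : Fin 3) :
    T.word u (i :: l) (Function.update h i a) = T.letter u i a * T.word u l h := by
  rw [word_cons, Function.update_self]
  congr 1
  exact word_congr fun j hj => Function.update_of_ne (ne_of_mem_of_not_mem hj hi) _ _

theorem letter_mul_letter_self {l : List (Fin n)} (hT : T.IsTruncated 1 l u) {i : Fin n}
    (hi : i ∈ l) {a b : Fin 3} (ha : a ≠ 0) (hb : b ≠ 0) :
    T.letter u i a * T.letter u i b = 0 := by
  have h1 := hT.mul_self i hi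
  have h2 := hT.x_pow_mul i hi
  have h3 := hT.x_pow i hi
  rw [pow_one] at h2
  have ha' : a = 1 ∨ a = 2 := by omega
  have hb' : b = 1 ∨ b = 2 := by omega
  rcases ha' with rfl | rfl <;> rcases hb' with rfl | rfl
  · exact h1
  · exact (T.x_comm i (u i)).symm.trans h2
  · exact h2
  · exact (pow_two _).symm.trans h3

theorem exists_letter_mul_letter {l : List (Fin n)} (hT : T.IsTruncated 1 l u) {i j : Fin n}
    (hi : i ∈ l) (hj : j ∈ l) (a b : Fin 3) :
    ∃ r : k, T.letter u i a * T.letter u j b = r • (T.letter u j b * T.letter u i a) := by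
  have h3 (a : Fin 3) : a = 0 ∨ a = 1 ∨ a = 2 := by omega
  rcases h3 a with rfl | rfl | rfl
  · exact ⟨1, by simp⟩
  · rcases h3 b with rfl | rfl | rfl
    · exact ⟨1, by simp⟩
    · refine ⟨-1, ?_⟩
      rw [letter_one, letter_one, hT.comm i hi, sgn_of_mem_odd odd_one (hT.mem_grade j hj)]
      simp
    · exact ⟨1, by simp [T.x_comm]⟩
  · exact ⟨1, by simp [T.x_comm]⟩

/-- Multiplying an ordered product of letters by a letter yields a multiple of such a product. -/
theorem exists_letter_mul_word {l' : List (Fin n)} (hT : T.IsTruncated 1 l' u) {l : List (Fin n)}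
    (hl : l.Nodup) (hll' : ∀ i ∈ l, i ∈ l') {i : Fin n} (hi : i ∈ l) (a : Fin 3)
    (h : Fin n → Fin 3) : ∃ (r : k) (h' : Fin n → Fin 3),
      T.letter u i a * T.word u l h = r • T.word u l h' := by
  by_cases ha : a = 0
  · exact ⟨1, h, by simp [ha]⟩
  induction l with
  | nil => exact absurd hi List.not_mem_nil
  | cons j l ih =>
    obtain ⟨hj, hl⟩ := List.nodup_cons.1 hl
    by_cases hij : i = j
    · subst hij
      by_cases h0 : h i = 0
      · refine ⟨1, Function.update h i a, ?_⟩
        rw [word_cons_update hj, word_cons, h0, letter_zero, one_mul, one_smul]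
      · refine ⟨0, h, ?_⟩
        rw [word_cons, ← mul_assoc, letter_mul_letter_self hT (hll' i hi) ha h0, zero_mul,
          zero_smul]
    · obtain ⟨r, h', hr⟩ := ih hl (fun i hi => hll' i (List.mem_cons_of_mem j hi))
        ((List.mem_cons.1 hi).resolve_left hij)
      obtain ⟨r', hr'⟩ := exists_letter_mul_letter hT (hll' i hi) (hll' j List.mem_cons_self)
        a (h j)
      refine ⟨r' * r, Function.update h' j (h j), ?_⟩
      rw [word_cons, ← mul_assoc, hr', smul_mul_assoc, mul_assoc, hr, mul_smul_comm, smul_smul,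
        word_cons_update hj]

/-- The ordered products of letters span. -/
theorem span_word_eq_top {l : List (Fin n)} (hl : l.Nodup) (hmem : ∀ i, i ∈ l)
    (hT : T.IsTruncated 1 l u)
    (hgen : Algebra.adjoin k (Set.range T.polyMap ∪ Set.range u) = ⊤) :
    Submodule.span k (Set.range (T.word u l)) = ⊤ := by
  set V := Submodule.span k (Set.range (T.word u l))
  have hletter (i : Fin n) (a : Fin 3) (v : T.carrier) (hv : v ∈ V) : T.letter u i a * v ∈ V := by
    induction hv using Submodule.span_induction with
    | mem v hv =>
      obtain ⟨h, rfl⟩ := hv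
      obtain ⟨r, h', hr⟩ := exists_letter_mul_word hT hl (fun _ => id) (hmem i) a h
      rw [hr]
      exact Submodule.smul_mem _ r (Submodule.subset_span ⟨h', rfl⟩)
    | zero => rw [mul_zero]; exact zero_mem _
    | add v w _ _ hv hw => rw [mul_add]; exact add_mem hv hw
    | smul r v _ hv => rw [mul_smul_comm]; exact Submodule.smul_mem _ r hv
  have hpoly (f : MvPolynomial (Fin n) k) (v : T.carrier) (hv : v ∈ V) : T.polyMap f * v ∈ V := by
    induction f using MvPolynomial.induction_on generalizing v with
    | C a =>
      rw [← algebraMap_eq, AlgHom.commutes, ← Algebra.smul_def]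
      exact Submodule.smul_mem _ a hv
    | add f g hf hg =>
      rw [map_add, add_mul]
      exact add_mem (hf v hv) (hg v hv)
    | mul_X f i hf =>
      rw [map_mul, mul_assoc, polyMap_X]
      exact hf _ (hletter i 2 v hv)
  have hmul (t : T.carrier) (ht : t ∈ Algebra.adjoin k (Set.range T.polyMap ∪ Set.range u)) :
      ∀ v ∈ V, t * v ∈ V := by
    induction ht using Algebra.adjoin_induction with
    | mem t ht =>
      rcases ht with ⟨f, rfl⟩ | ⟨i, rfl⟩
      · exact hpoly f
      · exact hletter i 1
    | algebraMap r =>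
      intro v hv
      rw [← Algebra.smul_def]
      exact Submodule.smul_mem _ r hv
    | add t t' _ _ h h' =>
      intro v hv
      rw [add_mul]
      exact add_mem (h v hv) (h' v hv)
    | mul t t' _ _ h h' =>
      intro v hv
      rw [mul_assoc]
      exact h _ (h' v hv)
  have hone : (1 : T.carrier) ∈ V := Submodule.subset_span ⟨0, by simp [word]⟩
  refine eq_top_iff.2 fun t _ => ?_
  rw [← mul_one t]
  exact hmul t (hgen ▸ Algebra.mem_top) 1 hone

theorem word_eq_polyMap_mul (l : List (Fin n)) (h : Fin n → Fin 3) :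
    T.word u l h = T.polyMap (l.map fun i => if h i = 2 then X i else 1).prod *
      T.word u l fun i => if h i = 2 then 0 else h i := by
  induction l with
  | nil => simp [word]
  | cons i l ih =>
    rw [word_cons, word_cons, ih, List.map_cons, List.prod_cons, map_mul]
    split_ifs with hi
    · rw [hi, letter_two, letter_zero, one_mul, polyMap_X, mul_assoc]
    · rw [map_one, one_mul, ← mul_assoc, ← polyMap_comm, mul_assoc]

theorem word_eq_zero {σ : Finset (Fin n)} (hσ : T.polyMap (∏ i ∈ σ, X i) = 0)
    {h : Fin n → Fin 3} (h2 : (Finset.univ.filter fun i => h i = 2) = σ) :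
    T.word u (List.finRange n) h = 0 := by
  rw [word_eq_polyMap_mul, ← Fin.prod_univ_def, ← Finset.prod_filter, h2, hσ, zero_mul]

open CellularCochain MomentAngleCell in
/-- A DGA that satisfies the relations of the cellular cochain algebra and is generated by
the `x i` and the `u i` is isomorphic to the cellular cochain algebra: the ordered products of
letters span it, vanish outside the cells of the moment-angle complex, and map to the basis
dual to the cells. -/
theorem bijective_of_isTruncated {K : AbstractSimplicialComplex (Fin n)}
    (hT : T.IsTruncated 1 (List.finRange n) u)
    (hgen : Algebra.adjoin k (Set.range T.polyMap ∪ Set.range u) = ⊤)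
    (hK : ∀ σ : Finset (Fin n), σ.Nonempty → σ ∉ K → T.polyMap (∏ i ∈ σ, X i) = 0)
    (g : Hom T (cellularParamDGA k K)) (hg : ∀ i, g.toAlgHom (u i) = gen k K i 1) :
    Function.Bijective g.toAlgHom := by
  classical
  have hword (h : Fin n → Fin 3) :
      g.toAlgHom (T.word u (List.finRange n) h) = indicator k K h := by
    rw [word, map_list_prod, List.map_map]
    refine Eq.trans ?_ ((prod_gen (List.pairwise_lt_finRange n) h).trans ?_)
    · refine congrArg List.prod (List.map_congr_left fun i _ => ?_)
      change g.toAlgHom (T.letter u i (h i)) = _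
      have h3 : h i = 0 ∨ h i = 1 ∨ h i = 2 := by omega
      rcases h3 with h0 | h0 | h0 <;> rw [h0]
      · exact map_one _
      · exact hg i
      · exact g.map_x i
    · simp
  let P (h : Fin n → Fin 3) : Prop :=
    Set.univ.pi (fun i => diskCell (h i)) ⊆ momentAngleComplex K
  let coeffAt (h : Fin n → Fin 3) : CellularCochain k K →ₗ[k] k :=
    { toFun := fun f => if hc : P h then f ⟨h, hc⟩ else 0
      map_add' := fun f f' => by split_ifs <;> simp
      map_smul' := fun r f => by split_ifs <;> simp }
  let s : CellularCochain k K →ₗ[k] T.carrier :=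
    ∑ h : Fin n → Fin 3, (coeffAt h).smulRight (T.word u (List.finRange n) h)
  have hs (f : CellularCochain k K) :
      s f = ∑ h : Fin n → Fin 3, coeffAt h f • T.word u (List.finRange n) h := by
    simp [s, LinearMap.sum_apply]
  have hgs (f : CellularCochain k K) : g.toAlgHom (s f) = f := by
    rw [hs, map_sum]
    refine ext_apply fun c => ?_
    refine (map_sum (evalHom c) _ _).trans ?_
    rw [Finset.sum_eq_single c.factor]
    · rw [map_smul, hword]
      change coeffAt c.factor f * indicator k K c.factor c = f c
      rw [indicator_apply, if_pos rfl, mul_one]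
      exact dif_pos c.subset
    · intro h _ hne
      rw [map_smul, hword]
      change coeffAt h f * indicator k K h c = 0
      rw [indicator_apply, if_neg hne.symm, mul_zero]
    · simp
  have hsg (t : T.carrier) : s (g.toAlgHom t) = t := by
    have ht : t ∈ Submodule.span k (Set.range (T.word u (List.finRange n))) := by
      rw [span_word_eq_top (List.nodup_finRange n) List.mem_finRange hT hgen]
      trivial
    induction ht using Submodule.span_induction with
    | mem t ht =>
      obtain ⟨h, rfl⟩ := ht
      rw [hword, hs, Finset.sum_eq_single h]
      · by_cases hc : P h
        · have : coeffAt h (indicator k K h) = 1 := (dif_pos hc).trans (if_pos rfl)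
          rw [this, one_smul]
        · have hc' := mt (pi_subset_iff (K := K) h).2 hc
          rw [not_or] at hc'
          rw [word_eq_zero (hK _ (Finset.nonempty_iff_ne_empty.2 hc'.1) hc'.2) rfl, smul_zero]
      · intro h' _ hne
        have : coeffAt h' (indicator k K h) = 0 := by
          by_cases hc : P h'
          · exact (dif_pos hc).trans (if_neg hne)
          · exact dif_neg hc
        rw [this, zero_smul]
      · simp
    | zero => exact (congrArg s (map_zero g.toAlgHom)).trans (map_zero s)
    | add t t' _ _ ht ht' =>
      refine (congrArg s (map_add g.toAlgHom t t')).trans ((map_add s _ _).trans ?_)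
      rw [ht, ht']
    | smul r t _ ht =>
      refine (congrArg s (map_smul g.toAlgHom r t)).trans ((map_smul s r _).trans ?_)
      rw [ht]
  exact ⟨Function.LeftInverse.injective hsg, fun f => ⟨s f, hgs f⟩⟩

/-- The truncated Koszul algebra of the Stanley-Reisner ring is the cellular cochain algebra. -/
theorem quasiIsoTo_cellularCochainAlgebra (K : AbstractSimplicialComplex (Fin n)) :
    QuasiIsoTo (truncatedKoszul 1 (List.finRange n) (stanleyReisner k K)).toDGA
      (cellularCochainAlgebra k K) := by
  obtain ⟨ι, u, hu, hgen, huniv⟩ := exists_isTruncated_truncatedKoszul (stanleyReisner k K) 1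
    (List.nodup_finRange n)
  obtain ⟨f⟩ := exists_hom_stanleyReisner (cellularParamDGA k K)
    fun σ h hσ => CellularCochain.polyMap_prod_X_eq_zero h hσ
  obtain ⟨g, -, hg⟩ := huniv _ _ (CellularCochain.gen_one_isTruncated _) f
  refine ⟨g.toHom, g.isQuasiIso_of_bijective (bijective_of_isTruncated hu ?_ ?_ g
    fun i => hg i (List.mem_finRange i))⟩
  · rw [← hgen]
    congr 2
    · ext t
      constructor
      · rintro ⟨f, rfl⟩
        exact ⟨_, ι.map_polyMap f⟩
      · rintro ⟨y, rfl⟩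
        obtain ⟨f, rfl⟩ := stanleyReisner_polyMap_surjective K y
        exact ⟨f, (ι.map_polyMap f).symm⟩
    · ext t
      simp
  · intro σ h hσ
    rw [← ι.map_polyMap, stanleyReisner_polyMap_eq_zero h hσ, map_zero]

end ParamDGA

/-! ### Minimal free resolutions with a multiplicative structure -/

namespace MinimalFreeResolution

open MvPolynomial DGA

variable {n : ℕ} {k : Type u} [CommRing k] {K : AbstractSimplicialComplex (Fin n)}
  (P : MinimalFreeResolution k K)

variable {P} in
theorem piece_induction {p : P.carrier → Prop} (h0 : p 0) (hadd : ∀ x y, p x → p y → p (x + y))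
    (hpiece : ∀ i j, ∀ x ∈ P.piece i j, p x) (x : P.carrier) : p x := by
  classical
  let := P.isInternal.chooseDecomposition
  rw [← DirectSum.sum_support_decompose (fun pq : ℕ × ℤ => P.piece pq.1 pq.2) x]
  exact Finset.sum_induction _ p hadd h0 fun pq _ => hpiece _ _ _ (SetLike.coe_mem _)

open Classical in
/-- The projection to the part of total degree `i`. An element of homological degree `p` and
internal degree `q` has the total degree `2 * q - p`. -/
noncomputable def totalProj (i : ℤ) : P.carrier →+ P.carrier :=
  letI := P.isInternal.chooseDecomposition
  (DirectSum.toAddMonoid fun pq : ℕ × ℤ =>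
    if 2 * pq.2 - pq.1 = i then (P.piece pq.1 pq.2).subtype else 0).comp
    (DirectSum.decomposeAddEquiv fun pq : ℕ × ℤ => P.piece pq.1 pq.2).toAddMonoidHom

variable {P}

theorem totalProj_of_mem {p : ℕ} {q i : ℤ} {x : P.carrier} (hx : x ∈ P.piece p q)
    (h : 2 * q - p = i) : P.totalProj i x = x := by
  let := P.isInternal.chooseDecomposition
  have hdec := DirectSum.decompose_of_mem (fun pq : ℕ × ℤ => P.piece pq.1 pq.2) (i := (p, q)) hx
  simp only [totalProj, AddMonoidHom.comp_apply]
  change DirectSum.toAddMonoid _ (DirectSum.decompose _ x) = x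
  rw [hdec, DirectSum.toAddMonoid_of, if_pos h]
  rfl

theorem totalProj_of_mem_ne {p : ℕ} {q i : ℤ} {x : P.carrier} (hx : x ∈ P.piece p q)
    (h : 2 * q - p ≠ i) : P.totalProj i x = 0 := by
  let := P.isInternal.chooseDecomposition
  have hdec := DirectSum.decompose_of_mem (fun pq : ℕ × ℤ => P.piece pq.1 pq.2) (i := (p, q)) hx
  simp only [totalProj, AddMonoidHom.comp_apply]
  change DirectSum.toAddMonoid _ (DirectSum.decompose _ x) = 0
  rw [hdec, DirectSum.toAddMonoid_of, if_neg h]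
  rfl

theorem totalProj_induction {p : P.carrier → Prop} (i : ℤ) (h0 : p 0)
    (hadd : ∀ x y, p x → p y → p (x + y))
    (hpiece : ∀ (j : ℕ) (q : ℤ), 2 * q - j = i → ∀ x ∈ P.piece j q, p x) {x : P.carrier}
    (hx : P.totalProj i x = x) : p x := by
  rw [← hx]
  refine piece_induction (p := fun x => p (P.totalProj i x)) ?_ (fun x y hx hy => ?_)
    (fun j q x hx => ?_) x
  · rwa [map_zero]
  · rw [map_add]
    exact hadd _ _ hx hy
  · by_cases h : 2 * q - j = i
    · rw [totalProj_of_mem hx h]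
      exact hpiece j q h x hx
    · rwa [totalProj_of_mem_ne hx h]

namespace MultiplicativeStructure

variable (M : P.MultiplicativeStructure)

/-- The ring structure on a resolution given by its multiplicative structure. -/
noncomputable abbrev ring : Ring P.carrier :=
  { P.addCommGroup with
    mul := fun x y => M.mul x y
    one := M.one
    mul_assoc := M.mul_assoc
    one_mul := M.one_mul
    mul_one := M.mul_one
    zero_mul := fun x => by change M.mul 0 x = 0; simp
    mul_zero := fun x => by change M.mul x 0 = 0; simp
    left_distrib := fun x y z => by change M.mul x (y + z) = M.mul x y + M.mul x z; simp
    right_distrib := fun x y z => by change M.mul (x + y) z = M.mul x z + M.mul y z; simp }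

/-- The `k`-algebra structure on a resolution given by its multiplicative structure. -/
noncomputable abbrev algebra : @Algebra k P.carrier _ M.ring.toSemiring :=
  letI := M.ring
  letI : Module k P.carrier := Module.compHom P.carrier (C : k →+* MvPolynomial (Fin n) k)
  Algebra.ofModule
    (fun r x y => by
      change M.mul ((C r : MvPolynomial (Fin n) k) • x) y =
        (C r : MvPolynomial (Fin n) k) • M.mul x y
      simp)
    (fun r x y => by
      change M.mul x ((C r : MvPolynomial (Fin n) k) • y) =
        (C r : MvPolynomial (Fin n) k) • M.mul x y
      simp)

/-- A minimal free resolution with a multiplicative structure as a DGA, graded by the total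
degree, in which the variables are central cocycles. -/
noncomputable def paramDGA : ParamDGA k n where
  carrier := P.carrier
  ring := M.ring
  algebra := M.algebra
  grade i :=
    letI := M.ring
    letI := M.algebra
    { carrier := {x | P.totalProj i x = x}
      add_mem' := fun {x y} (hx : P.totalProj i x = x) (hy : P.totalProj i y = y) => by
        change P.totalProj i (x + y) = x + y
        rw [map_add, hx, hy]
      zero_mem' := map_zero _
      smul_mem' := fun r x (hx : P.totalProj i x = x) => by
        change P.totalProj i ((C r : MvPolynomial (Fin n) k) • x) =
          (C r : MvPolynomial (Fin n) k) • x
        refine totalProj_induction (p := fun x => P.totalProj i ((C r : MvPolynomial (Fin n) k) • x)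
          = (C r : MvPolynomial (Fin n) k) • x) i ?_ (fun x y hx hy => ?_)
          (fun j q h x hx => ?_) hx
        · simp
        · rw [smul_add, map_add, hx, hy]
        · have := P.smul_mem (isWeightedHomogeneous_C (fun _ => (1 : ℤ)) r) hx
          rw [zero_add] at this
          exact totalProj_of_mem this h }
  isInternal := by
    let := M.ring
    let := M.algebra
    refine isInternal_of_projections P.totalProj (fun i x hx => hx) ?_ ?_
    · intro i j hij x hx
      refine totalProj_induction (p := fun x => P.totalProj j x = 0) i (map_zero _)
        (fun x y hx hy => ?_) (fun l q h x hx => ?_) hx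
      · rw [map_add, hx, hy, add_zero]
      · exact totalProj_of_mem_ne hx (h ▸ hij)
    · intro x
      refine piece_induction (p := fun x => x ∈ (_ : Submodule k P.carrier)) (zero_mem _)
        (fun x y hx hy => add_mem hx hy) (fun j q x hx => ?_) x
      exact Submodule.mem_iSup_of_mem (2 * q - j) (totalProj_of_mem hx rfl)
  one_mem := totalProj_of_mem M.one_mem (by simp)
  mul_mem {i j x y} hx hy := by
    change P.totalProj (i + j) (M.mul x y) = M.mul x y
    refine totalProj_induction
      (p := fun x => P.totalProj (i + j) (M.mul x y) = M.mul x y) i (by simp)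
      (fun x x' hx hx' => by simp [hx, hx']) (fun p q h x hx => ?_) hx
    refine totalProj_induction
      (p := fun y => P.totalProj (i + j) (M.mul x y) = M.mul x y) j (by simp)
      (fun y y' hy hy' => by simp [hy, hy']) (fun p' q' h' y hy => ?_) hy
    refine totalProj_of_mem (M.mul_mem hx hy) ?_
    push_cast
    linarith
  d :=
    letI := M.ring
    letI := M.algebra
    { toFun := P.d
      map_add' := map_add P.d
      map_smul' := fun r x => map_smul P.d (C r : MvPolynomial (Fin n) k) x }
  d_mem {i x} hx := by
    change P.totalProj (i + 1) (P.d x) = P.d x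
    refine totalProj_induction (p := fun x => P.totalProj (i + 1) (P.d x) = P.d x) i (by simp)
      (fun x y hx hy => by simp [hx, hy]) (fun p q h x hx => ?_) hx
    cases p with
    | zero => rw [P.d_zero hx, map_zero]
    | succ p =>
      refine totalProj_of_mem (P.d_mem hx) ?_
      push_cast at h
      linarith
  d_d := P.d_d
  leibniz {i x} y hx := by
    change P.d (M.mul x y) = M.mul (P.d x) y + (i.negOnePow : ℤ) • M.mul x (P.d y)
    refine totalProj_induction (p := fun x => P.d (M.mul x y) = M.mul (P.d x) y +
      (i.negOnePow : ℤ) • M.mul x (P.d y)) i (by simp) (fun x x' hx hx' => ?_)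
      (fun p q h x hx => ?_) hx
    · simp only [map_add, LinearMap.add_apply, hx, hx', smul_add]
      abel
    · have hsign : ((i.negOnePow : ℤˣ) : ℤ) = (-1) ^ p := by
        rw [← h, Int.negOnePow_sub, Int.negOnePow_even _ (even_two_mul q), _root_.one_mul,
          Int.negOnePow_def, zpow_natCast]
        push_cast
        rfl
      rw [M.leibniz y hx, hsign]
  x i := (X i : MvPolynomial (Fin n) k) • M.one
  x_mem i := totalProj_of_mem (P.smul_mem (isWeightedHomogeneous_X k _ i) M.one_mem) (by simp)
  d_x i := by
    change P.d ((X i : MvPolynomial (Fin n) k) • M.one) = 0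
    rw [map_smul, P.d_zero M.one_mem, smul_zero]
  x_comm i x := by
    change M.mul ((X i : MvPolynomial (Fin n) k) • M.one) x =
      M.mul x ((X i : MvPolynomial (Fin n) k) • M.one)
    simp [M.one_mul, M.mul_one]

theorem x_mul (i : Fin n) (x : P.carrier) :
    @HMul.hMul M.paramDGA.carrier M.paramDGA.carrier M.paramDGA.carrier _ (M.paramDGA.x i) x =
      (X i : MvPolynomial (Fin n) k) • x := by
  change M.mul ((X i : MvPolynomial (Fin n) k) • M.one) x = _
  simp [M.one_mul]

/-- A free module over the polynomial ring admits division by the variables, coefficientwise. -/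
theorem isDivisible (i : Fin n) : M.paramDGA.IsDivisible 0 i := by
  obtain ⟨ι, b, -⟩ := P.free
  let D : P.carrier →+ P.carrier := b.repr.symm.toLinearMap.toAddMonoidHom.comp
    ((Finsupp.mapRange.addMonoidHom (divXPow i 1)).comp b.repr.toLinearMap.toAddMonoidHom)
  have hD (x : P.carrier) : D x =
      b.repr.symm (Finsupp.mapRange (divXPow i 1) (map_zero _) (b.repr x)) := rfl
  have hDi (x : P.carrier) : D ((X i : MvPolynomial (Fin n) k) • x) = x := by
    rw [hD, LinearEquiv.symm_apply_eq]
    ext1 l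
    rw [Finsupp.mapRange_apply, map_smul, Finsupp.smul_apply, smul_eq_mul]
    simpa using divXPow_X_pow_mul i 1 (b.repr x l)
  have hDj (j : Fin n) (hj : j ≠ i) (x : P.carrier) :
      D ((X j : MvPolynomial (Fin n) k) • x) = (X j : MvPolynomial (Fin n) k) • D x := by
    rw [hD, hD, ← map_smul]
    congr 1
    ext1 l
    rw [Finsupp.mapRange_apply, map_smul, Finsupp.smul_apply, Finsupp.smul_apply,
      Finsupp.mapRange_apply, smul_eq_mul, smul_eq_mul, divXPow_X_mul hj]
  refine ⟨D, fun x => ?_, fun j hj x => ?_⟩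
  · rw [zero_add, pow_one, pow_zero, _root_.one_mul]
    exact (congrArg D (M.x_mul i x)).trans (hDi x)
  · exact (congrArg D (M.x_mul j x)).trans ((hDj j hj x).trans (M.x_mul j _).symm)

/-- The augmentation as a morphism of DGAs. -/
noncomputable def augmentation : M.paramDGA.Hom (ParamDGA.stanleyReisner k K) where
  toAlgHom :=
    { toFun := P.ε
      map_one' := M.ε_one
      map_mul' := M.ε_mul
      map_zero' := map_zero P.ε
      map_add' := map_add P.ε
      commutes' := fun r => by
        change P.ε ((C r : MvPolynomial (Fin n) k) • M.one) = _
        rw [map_smul, M.ε_one]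
        exact (Algebra.algebraMap_eq_smul_one (A := MvPolynomial (Fin n) k ⧸
          stanleyReisnerIdeal k K) (C r : MvPolynomial (Fin n) k)).symm }
  map_grade {i x} hx := by
    refine totalProj_induction (p := fun x => P.ε x ∈ (ParamDGA.stanleyReisner k K).grade i) i
      ?_ (fun x y hx hy => ?_) (fun p q h x hx => ?_) hx
    · rw [map_zero]
      exact zero_mem _
    · rw [map_add]
      exact add_mem hx hy
    · cases p with
      | zero =>
        obtain ⟨f, hf, hε⟩ := P.ε_piece hx
        rw [hε]
        refine ⟨f, ?_, rfl⟩
        intro m hm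
        have := hf hm
        simp only [Finsupp.weight_apply, Finsupp.sum] at this ⊢
        push_cast at h
        rw [← h, ← this, Finset.mul_sum]
        simp [_root_.mul_comm]
      | succ p =>
        rw [P.ε_pos hx]
        exact zero_mem _
  map_d x := (P.ε_d x).trans (ParamDGA.stanleyReisner_d K _).symm
  map_x i := by
    change P.ε ((X i : MvPolynomial (Fin n) k) • M.one) = _
    rw [map_smul, M.ε_one]
    exact (Algebra.algebraMap_eq_smul_one (A := MvPolynomial (Fin n) k ⧸
      stanleyReisnerIdeal k K) (X i : MvPolynomial (Fin n) k)).symm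

theorem isQuasiIso_augmentation : M.augmentation.IsQuasiIso := by
  refine (Hom.isQuasiIso_iff _).2 ⟨fun z hz b hb => P.exact z hz
    (hb.symm.trans (ParamDGA.stanleyReisner_d K b)), fun w _ => ?_⟩
  obtain ⟨x, rfl⟩ := P.ε_surjective w
  suffices h : ∃ z, P.d z = 0 ∧ P.ε z = P.ε x by
    obtain ⟨z, hz, hzx⟩ := h
    exact ⟨z, hz, 0, (map_zero _).trans (sub_eq_zero.2 hzx).symm⟩
  refine piece_induction (p := fun x => ∃ z, P.d z = 0 ∧ P.ε z = P.ε x) ⟨0, by simp⟩ ?_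
    (fun p q x hx => ?_) x
  · rintro x y ⟨z, hz, hzx⟩ ⟨w, hw, hwy⟩
    exact ⟨z + w, by simp [hz, hw], by simp [hzx, hwy]⟩
  · cases p with
    | zero => exact ⟨x, P.d_zero hx, rfl⟩
    | succ p => exact ⟨0, map_zero _, by rw [map_zero, P.ε_pos hx]⟩

/-- The differential of `P / (x₁, …, xₙ) P` vanishes by minimality. -/
theorem truncatedKoszul_d_eq_zero
    (y : (ParamDGA.truncatedKoszul 0 (List.finRange n) M.paramDGA).carrier) :
    (ParamDGA.truncatedKoszul 0 (List.finRange n) M.paramDGA).d y = 0 := by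
  obtain ⟨ι, u, hu, hgen, -⟩ := ParamDGA.exists_isTruncated_truncatedKoszul M.paramDGA 0
    (List.nodup_finRange n)
  have hy : y ∈ ι.toAlgHom.range := by
    have : (⊤ : Subalgebra k _) ≤ ι.toAlgHom.range := by
      rw [← hgen]
      refine Algebra.adjoin_le (Set.union_subset (fun _ h => h) ?_)
      rintro _ ⟨i, hi, rfl⟩
      have h0 := hu.x_pow_mul i hi
      rw [pow_zero, _root_.one_mul] at h0
      rw [h0]
      exact zero_mem _
    exact this Algebra.mem_top
  obtain ⟨a, rfl⟩ := hy
  have hX (i : Fin n) (m : P.carrier) :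
      ι.toAlgHom ((X i : MvPolynomial (Fin n) k) • m : P.carrier) = 0 := by
    have h0 := hu.x_pow i (List.mem_finRange i)
    rw [zero_add, pow_one] at h0
    refine (congrArg ι.toAlgHom (M.x_mul i m).symm).trans ((map_mul ι.toAlgHom _ _).trans ?_)
    rw [ι.map_x, h0, zero_mul]
  have hspan (f : MvPolynomial (Fin n) k) (hf : f ∈ Ideal.span (Set.range X)) :
      ∀ m : P.carrier, ι.toAlgHom (f • m : P.carrier) = 0 := by
    induction hf using Submodule.span_induction with
    | mem f hf =>
      obtain ⟨i, rfl⟩ := hf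
      exact hX i
    | zero =>
      intro m
      rw [zero_smul]
      exact map_zero ι.toAlgHom
    | add f g _ _ hf hg =>
      intro m
      rw [add_smul]
      exact (map_add ι.toAlgHom _ _).trans (by rw [hf, hg, add_zero])
    | smul g f _ hf =>
      intro m
      rw [smul_eq_mul, _root_.mul_comm, mul_smul]
      exact hf _
  refine (ι.map_d a).symm.trans ?_
  refine Submodule.smul_induction_on (p := fun x : P.carrier => ι.toAlgHom x = 0) (P.minimal a)
    (fun f hf m _ => hspan f hf m) fun x y hx hy => ?_
  exact (map_add ι.toAlgHom _ _).trans (by rw [hx, hy, add_zero])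

end MultiplicativeStructure

end MinimalFreeResolution

theorem proposition5p3 {n : ℕ} {k : Type u} [CommRing k]
    (K : AbstractSimplicialComplex (Fin n)) (P : MinimalFreeResolution k K)
    (hP : Nonempty P.MultiplicativeStructure) :
    (cellularCochainAlgebra k K).IsFormal := by
  obtain ⟨M⟩ := hP
  have hl := List.nodup_finRange n
  obtain ⟨f, hf⟩ := ParamDGA.exists_quasiIso_koszul M.augmentation M.isQuasiIso_augmentation
    (List.finRange n)
  obtain ⟨g, hg⟩ := ParamDGA.exists_quasiIso_truncatedKoszul
    (ParamDGA.isDivisible_stanleyReisner (k := k) K) hl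
  obtain ⟨h, hh⟩ := ParamDGA.exists_quasiIso_truncatedKoszul M.isDivisible hl
  refine DGA.isFormal_of_eqvGen ?_ M.truncatedKoszul_d_eq_zero
  refine .trans _ _ _ (.symm _ _ ?_) (.rel _ _ ⟨h.toHom, hh⟩)
  exact .trans _ _ _ (.rel _ _ ⟨_, hg.comp hf⟩)
    (.rel _ _ (ParamDGA.quasiIsoTo_cellularCochainAlgebra K))
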